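/- Consider two single-server FIFO queues with infinite buffers in tandem. Let $T_n$, $n\in\mathbb Z$, be the arrival time of customer $n$ at the first station, let $\tau_n=T_{n+1}-T_n\ge 0$, and let $\sigma^{(i)}_n\ge 0$ be the service time of customer $n$ at station $i\in\{1,2\}$. Assume that $(\tau_n)_{n\in\mathbb Z}$ is an i.i.d. sequence with finite mean, that the pairs $(\sigma^{(1)}_n,\sigma^{(2)}_n)_{n\in\mathbb Z}$ form an i.i.d. sequence (the two components of a pair may be dependent), that these two sequences are independent of each other, that $\mathbb E[e^{\theta(\sigma^{(1)}_0+\sigma^{(2)}_0)}]<\infty$ for all $\theta$ in a neighbourhood of $0$, and that $\max(\mathbb E[\sigma^{(1)}_0],\mathbb E[\sigma^{(2)}_0])<\mathbb E[\tau_0]$. For $m\le n$ let $X_{[m,n]}$ be the time at which customer $n$ leaves the second station when the network starts empty and is fed by customers $m,\dots,n$ only; let $Z_{[m,n]}=X_{[m,n]}-T_n$, let $Z=\lim_{n\to\infty}Z_{[-n,0]}$ (a nondecreasing limit), and let $Z^0_{[m,n]}$ be the value of $Z_{[m,n]}$ when all arrival times are replaced by $0$. Let $$\Lambda_T(\theta)=\log\mathbb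 E[e^{\theta(T_1-T_0)}],\qquad \Lambda_Z(\theta)=\lim_{n\to\infty}\frac1n\log\mathbb E\big[e^{\theta Z^0_{[1,n]}}\big]\in(-\infty,\infty],$$ $$\theta^*=\sup\{\theta>0:\ \Lambda_T(-\theta)+\Lambda_Z(\theta)<0\}\in(0,\infty],$$ $$Y_n=\sup_{-n\le q\le 0}\Big(\sum_{k=-n}^{q}\sigma^{(1)}_k+\sum_{k=q}^{0}\sigma^{(2)}_k\Big)-(T_0-T_{-n}).$$ Suppose that the sequence $(Y_n/n)_{n\ge1}$ satisfies a large deviation principle in $\mathbb R$ with speed $n$ and a good rate function $I:\mathbb R\to[0,\infty]$, and that $\Lambda_Z(\theta^*+\varepsilon)<\infty$ for some $\varepsilon>0$ (no condition if $\theta^*=\infty$). Then $$\lim_{x\to\infty}\frac1x\log\mathbb P(Z>x)=-\theta^*=-\inf_{\alpha>0}\frac{I(\alpha)}{\alpha}.$$ -/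

import Mathlib

open MeasureTheory ProbabilityTheory Filter Topology
open scoped ENNReal NNReal

noncomputable section

namespace Tandem

/-! ### Two single-server FIFO queues in tandem

`T : ℤ → ℝ` are the arrival epochs at the first station and `s₁ s₂ : ℤ → ℝ` are the service times
at the two stations.  In this section everything is defined path by path. -/

/-- Departure time of customer `m + j` from the first station, when the network starts empty and is
fed by the customers `m, m + 1, …` only. -/
def departure₁ (T s₁ : ℤ → ℝ) (m : ℤ) : ℕ → ℝ
  | 0 => T m + s₁ m
  | j + 1 => max (departure₁ T s₁ m j) (T (m + (j + 1))) + s₁ (m + (j + 1))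

/-- Departure time of customer `m + j` from the second station, when the network starts empty and is
fed by the customers `m, m + 1, …` only. -/
def departure₂ (T s₁ s₂ : ℤ → ℝ) (m : ℤ) : ℕ → ℝ
  | 0 => departure₁ T s₁ m 0 + s₂ m
  | j + 1 =>
      max (departure₂ T s₁ s₂ m j) (departure₁ T s₁ m (j + 1)) + s₂ (m + (j + 1))

/-- `X_{[m,n]}`, for `m ≤ n`: time of last activity when the network starts empty and is fed by the
customers `m, …, n` only, that is, the time at which customer `n` leaves the second station. -/
def lastActivity (T s₁ s₂ : ℤ → ℝ) (m n : ℤ) : ℝ :=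
  departure₂ T s₁ s₂ m (n - m).toNat

/-- The maximal dater `Z_{[m,n]} = X_{[m,n]} - T_n`, for `m ≤ n`. -/
def maximalDater (T s₁ s₂ : ℤ → ℝ) (m n : ℤ) : ℝ :=
  lastActivity T s₁ s₂ m n - T n

/-- The stationary maximal dater `Z = Z_{(-∞,0]} ∈ (-∞, ∞]`.  The sequence `Z_{[-n,0]}` is
nondecreasing in `n` (for nonnegative service times), so that its limit is its supremum. -/
def stationaryMaximalDater (T s₁ s₂ : ℤ → ℝ) : EReal :=
  ⨆ n : ℕ, ((maximalDater T s₁ s₂ (-(n : ℤ)) 0 : ℝ) : EReal)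

/-- `Y_n = sup_{-n ≤ q ≤ 0} (∑_{k=-n}^q s₁ k + ∑_{k=q}^0 s₂ k) - (T_0 - T_{-n})`. -/
def pathY (T s₁ s₂ : ℤ → ℝ) (n : ℕ) : ℝ :=
  (Finset.Icc (-(n : ℤ)) 0).sup' ⟨0, by simp⟩
      (fun q => ∑ k ∈ Finset.Icc (-(n : ℤ)) q, s₁ k + ∑ k ∈ Finset.Icc q 0, s₂ k)
    - (T 0 - T (-(n : ℤ)))

/-! ### Logarithmic moment generating functions and the decay rate -/

variable {Ω : Type*} [MeasurableSpace Ω]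

/-- `log 𝔼[exp (θ X)]` with values in `[-∞, ∞]`. -/
def logMgf (P : Measure Ω) (X : Ω → ℝ) (θ : ℝ) : EReal :=
  ENNReal.log (∫⁻ ω, ENNReal.ofReal (Real.exp (θ * X ω)) ∂P)

/-- `Λ_T(θ) = log 𝔼[exp (θ (T_1 - T_0))]`. -/
def LambdaT (P : Measure Ω) (T : ℤ → Ω → ℝ) (θ : ℝ) : EReal :=
  logMgf P (fun ω => T 1 ω - T 0 ω) θ

/-- `Λ_Z(θ) = lim_n (1/n) log 𝔼[exp (θ Z_{[1,n]}(N⁰))]`, where `N⁰` is the degenerate input process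
all of whose points are `0`.  For i.i.d. marks the limit exists by subadditivity, and it is then
the upper limit. -/
def LambdaZ (P : Measure Ω) (σ₁ σ₂ : ℤ → Ω → ℝ) (θ : ℝ) : EReal :=
  limsup (fun n : ℕ => ((1 / (n : ℝ) : ℝ) : EReal) *
    logMgf P (fun ω => maximalDater (fun _ => 0) (fun k => σ₁ k ω) (fun k => σ₂ k ω) 1 n) θ) atTop

/-- `θ* = sup {θ > 0 | Λ_T(-θ) + Λ_Z(θ) < 0} ∈ [-∞, ∞]`. -/
def thetaStar (P : Measure Ω) (T σ₁ σ₂ : ℤ → Ω → ℝ) : EReal :=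
  ⨆ θ ∈ {θ : ℝ | 0 < θ ∧ LambdaT P T (-θ) + LambdaZ P σ₁ σ₂ θ < 0}, (θ : EReal)

/-! ### Large deviation principles -/

/-- `I : E → [0, ∞]` is a good rate function: it is lower semicontinuous and its sublevel sets
`{I ≤ c}`, `c < ∞`, are compact. -/
structure IsGoodRateFunction {E : Type*} [TopologicalSpace E] (I : E → ℝ≥0∞) : Prop where
  lowerSemicontinuous : LowerSemicontinuous I
  isCompact_sublevel : ∀ c : ℝ≥0, IsCompact {x | I x ≤ c}

/-- The sequence of measures `μ n` satisfies the large deviation principle with speed `n` and rate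
function `I`: the lower bound holds for open sets and the upper bound for closed sets. -/
structure SatisfiesLDP {E : Type*} [TopologicalSpace E] [MeasurableSpace E]
    (μ : ℕ → Measure E) (I : E → ℝ≥0∞) : Prop where
  lower : ∀ G : Set E, IsOpen G →
    -((⨅ x ∈ G, I x : ℝ≥0∞) : EReal) ≤
      liminf (fun n : ℕ => ((1 / (n : ℝ) : ℝ) : EReal) * ENNReal.log (μ n G)) atTop
  upper : ∀ F : Set E, IsClosed F →
    limsup (fun n : ℕ => ((1 / (n : ℝ) : ℝ) : EReal) * ENNReal.log (μ n F)) atTop ≤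
      -((⨅ x ∈ F, I x : ℝ≥0∞) : EReal)

end Tandem

end

namespace Tandem

/-! ### Path-wise formulas -/

/-! Unrolling the two Lindley recursions writes departure times as longest paths through the two
stations, so $Z>x$ exactly when some $Y_n>x$ (`lt_stationaryMaximalDater_iff`). Almost surely $Y_n$
is the dater of $n+1$ customers without arrival constraints minus a sum of $n$ inter-arrival times.
The two parts are independent, so $\mathbb E[e^{\theta Y_n}]$ factorizes (`IsInput.emgf_randomY`),
and its upper exponential rate is $\Lambda_T(-\theta)+\Lambda_Z(\theta)$.

Upper bound: if this rate is negative, the moments are summable in $n$, and a union bound with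
Chernoff's inequality gives $\mathbb P(Z>x)\le Ke^{-\theta x}$. Lower bound: $\{Z>x\}$ contains
$\{Y_n>\beta n\}$ for $n=\lceil x/\beta\rceil$, and the LDP estimates this single event. Hence
$-\inf I(\alpha)/\alpha\le\liminf\le\limsup\le-\theta^*$.

It remains to show $\inf I(\alpha)/\alpha\le\theta^*$ (`IsInput.iInf_div_le_thetaStar`). Otherwise
the LDP upper bound makes $\mathbb P(Y_n\ge an)$ decay at rate at least $\theta'a$ for some
$\theta'>\theta^*$. For $\theta$ slightly above $\theta^*$, split $\mathbb E[e^{\theta Y_n}]$ by the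
size of $Y_n/n$: small values are controlled by a moment of order $\theta_0\le\theta^*$ with
negative rate (one exists by stability), intermediate values by the tails, large values by the
moment of order $\theta^*+\varepsilon$. So the rate at $\theta$ is negative, which contradicts the
definition of $\theta^*$. -/

lemma sum_Icc_add_one {f : ℤ → ℝ} {a b : ℤ} (h : a ≤ b + 1) :
    ∑ k ∈ Finset.Icc a (b + 1), f k = ∑ k ∈ Finset.Icc a b, f k + f (b + 1) := by
  have : Finset.Icc a (b + 1) = insert (b + 1) (Finset.Icc a b) := by
    ext x; simp only [Finset.mem_Icc, Finset.mem_insert]; omega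
  rw [this, Finset.sum_insert (by simp), add_comm]

/-- As a bound by an arbitrary `c`, each `max` in the recursion becomes a conjunction and each
service time a shift of `c`, so the induction needs no finite suprema. -/
lemma departure₁_le_iff (T s₁ : ℤ → ℝ) (m : ℤ) (j : ℕ) (c : ℝ) :
    departure₁ T s₁ m j ≤ c ↔
      ∀ p, m ≤ p → p ≤ m + j → T p + ∑ k ∈ Finset.Icc p (m + j), s₁ k ≤ c := by
  induction j generalizing c with
  | zero =>
    simp only [departure₁, Nat.cast_zero, add_zero]
    constructor
    · intro h p h₁ h₂
      obtain rfl : p = m := le_antisymm h₂ h₁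
      simpa using h
    · intro h
      simpa using h m le_rfl le_rfl
  | succ j ih =>
    rw [departure₁, ← le_sub_iff_add_le, max_le_iff, ih]
    push_cast
    simp only [← add_assoc]
    constructor
    · rintro ⟨h₁, h₂⟩ p hp hp'
      rw [sum_Icc_add_one hp']
      rcases eq_or_lt_of_le hp' with rfl | hlt
      · simp
        linarith
      · have := h₁ p hp (by omega)
        linarith
    · intro h
      refine ⟨fun p hp hp' => ?_, ?_⟩
      · have := h p hp (by omega)
        rw [sum_Icc_add_one (by omega)] at this
        linarith
      · have := h (m + j + 1) (by omega) le_rfl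
        simp at this
        linarith

/-- Here `p` is the customer at which the path starts and `q` the one at which it changes station.
In the induction step the new value of `q` comes from the first station. -/
lemma departure₂_le_iff (T s₁ s₂ : ℤ → ℝ) (m : ℤ) (j : ℕ) (c : ℝ) :
    departure₂ T s₁ s₂ m j ≤ c ↔ ∀ p q, m ≤ p → p ≤ q → q ≤ m + j →
      T p + (∑ k ∈ Finset.Icc p q, s₁ k + ∑ k ∈ Finset.Icc q (m + j), s₂ k) ≤ c := by
  induction j generalizing c with
  | zero =>
    simp only [departure₂, departure₁, Nat.cast_zero, add_zero]
    constructor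
    · intro h p q h₁ h₂ h₃
      obtain rfl : p = m := by omega
      obtain rfl : q = p := by omega
      simp
      linarith
    · intro h
      have := h m m le_rfl le_rfl le_rfl
      simp at this
      linarith
  | succ j ih =>
    rw [departure₂, ← le_sub_iff_add_le, max_le_iff, ih, departure₁_le_iff]
    push_cast
    simp only [← add_assoc]
    constructor
    · rintro ⟨h₁, h₂⟩ p q hp hpq hq
      rw [sum_Icc_add_one hq]
      rcases eq_or_lt_of_le hq with rfl | hlt
      · have := h₂ p hp hpq
        simp
        linarith
      · have := h₁ p q hp hpq (by omega)
        linarith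
    · intro h
      refine ⟨fun p q hp hpq hq => ?_, fun p hp hp' => ?_⟩
      · have := h p q hp hpq (by omega)
        rw [sum_Icc_add_one (f := s₂) (by omega)] at this
        linarith
      · have := h p (m + j + 1) hp hp' le_rfl
        simp at this
        linarith

lemma maximalDater_le_iff (T s₁ s₂ : ℤ → ℝ) {m n : ℤ} (hmn : m ≤ n) (c : ℝ) :
    maximalDater T s₁ s₂ m n ≤ c ↔ ∀ p q, m ≤ p → p ≤ q → q ≤ n →
      T p + (∑ k ∈ Finset.Icc p q, s₁ k + ∑ k ∈ Finset.Icc q n, s₂ k) - T n ≤ c := by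
  have h : m + ((n - m).toNat : ℤ) = n := by omega
  simp only [maximalDater, lastActivity, sub_le_iff_le_add, departure₂_le_iff, h]

/-- Without arrival constraints and for nonnegative service times, only paths from the first
customer matter. -/
lemma maximalDater_zero_le_iff {s₁ s₂ : ℤ → ℝ} (hs₁ : ∀ k, 0 ≤ s₁ k)
    {m n : ℤ} (hmn : m ≤ n) (c : ℝ) :
    maximalDater (fun _ => 0) s₁ s₂ m n ≤ c ↔ ∀ q, m ≤ q → q ≤ n →
      ∑ k ∈ Finset.Icc m q, s₁ k + ∑ k ∈ Finset.Icc q n, s₂ k ≤ c := by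
  rw [maximalDater_le_iff _ _ _ hmn]
  constructor
  · intro h q h₁ h₂
    simpa using h m q le_rfl h₁ h₂
  · intro h p q h₁ h₂ h₃
    have h₄ : ∑ k ∈ Finset.Icc p q, s₁ k ≤ ∑ k ∈ Finset.Icc m q, s₁ k :=
      Finset.sum_le_sum_of_subset_of_nonneg (Finset.Icc_subset_Icc_left h₁) fun _ _ _ => hs₁ _
    have := h q (h₁.trans h₂) h₃
    linarith

lemma pathY_le_iff (T s₁ s₂ : ℤ → ℝ) (n : ℕ) (c : ℝ) :
    pathY T s₁ s₂ n ≤ c ↔ ∀ q, -(n : ℤ) ≤ q → q ≤ 0 →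
      ∑ k ∈ Finset.Icc (-(n : ℤ)) q, s₁ k + ∑ k ∈ Finset.Icc q 0, s₂ k
        - (T 0 - T (-(n : ℤ))) ≤ c := by
  rw [pathY, sub_le_iff_le_add]
  refine (Finset.sup'_le_iff _ _).trans ?_
  simp only [sub_le_iff_le_add, Finset.mem_Icc, and_imp]

/-- This separates services from arrivals, the source of the independence used for the exponential
moments. -/
lemma pathY_eq (T s₂ : ℤ → ℝ) {s₁ : ℤ → ℝ} (hs₁ : ∀ k, 0 ≤ s₁ k) (n : ℕ) :
    pathY T s₁ s₂ n =
      maximalDater (fun _ => 0) s₁ s₂ (-(n : ℤ)) 0 - (T 0 - T (-(n : ℤ))) := by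
  refine eq_of_forall_ge_iff fun c => ?_
  rw [pathY_le_iff, sub_le_iff_le_add, maximalDater_zero_le_iff hs₁ (by simp)]
  simp only [sub_le_iff_le_add]

lemma maximalDater_le_iff_forall_pathY (T s₁ s₂ : ℤ → ℝ) (n : ℕ) (c : ℝ) :
    maximalDater T s₁ s₂ (-(n : ℤ)) 0 ≤ c ↔ ∀ i ≤ n, pathY T s₁ s₂ i ≤ c := by
  rw [maximalDater_le_iff _ _ _ (by simp)]
  simp only [pathY_le_iff]
  constructor
  · intro h i hi q hq hq'
    have := h (-(i : ℤ)) q (by omega) hq hq'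
    linarith
  · intro h p q hp hpq hq
    have hp' : -((-p).toNat : ℤ) = p := by omega
    have := h (-p).toNat (by omega) q (by omega) hq
    rw [hp'] at this
    linarith

/-- The stationary maximal dater exceeds `x` if and only if some `Y_n` does. -/
lemma lt_stationaryMaximalDater_iff (T s₁ s₂ : ℤ → ℝ) (x : ℝ) :
    (x : EReal) < stationaryMaximalDater T s₁ s₂ ↔ ∃ n : ℕ, x < pathY T s₁ s₂ n := by
  rw [stationaryMaximalDater, lt_iSup_iff]
  simp only [EReal.coe_lt_coe_iff]
  constructor
  · rintro ⟨n, hn⟩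
    by_contra! h
    exact absurd ((maximalDater_le_iff_forall_pathY T s₁ s₂ n x).2 fun i _ => h i) (not_le.2 hn)
  · rintro ⟨n, hn⟩
    refine ⟨n, ?_⟩
    by_contra! h
    exact absurd ((maximalDater_le_iff_forall_pathY T s₁ s₂ n x).1 h n le_rfl) (not_le.2 hn)

lemma departure₁_shift (s₁ : ℤ → ℝ) (a m : ℤ) (j : ℕ) :
    departure₁ (fun _ => 0) s₁ (m + a) j = departure₁ (fun _ => 0) (fun k => s₁ (k + a)) m j := by
  induction j with
  | zero => simp [departure₁]
  | succ j ih => simp only [departure₁, ih, add_right_comm]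

lemma departure₂_shift (s₁ s₂ : ℤ → ℝ) (a m : ℤ) (j : ℕ) :
    departure₂ (fun _ => 0) s₁ s₂ (m + a) j =
      departure₂ (fun _ => 0) (fun k => s₁ (k + a)) (fun k => s₂ (k + a)) m j := by
  induction j with
  | zero => simp [departure₂, departure₁]
  | succ j ih => simp only [departure₂, ih, departure₁_shift, add_right_comm]

lemma maximalDater_zero_shift (s₁ s₂ : ℤ → ℝ) (a m n : ℤ) :
    maximalDater (fun _ => 0) s₁ s₂ (m + a) (n + a) =
      maximalDater (fun _ => 0) (fun k => s₁ (k + a)) (fun k => s₂ (k + a)) m n := by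
  simp only [maximalDater, lastActivity, departure₂_shift, add_sub_add_right_eq_sub]

lemma maximalDater_zero_mono {s₁ s₂ : ℤ → ℝ} (hs₁ : ∀ k, 0 ≤ s₁ k) (hs₂ : ∀ k, 0 ≤ s₂ k)
    {m n n' : ℤ} (hmn : m ≤ n) (h : n ≤ n') :
    maximalDater (fun _ => 0) s₁ s₂ m n ≤ maximalDater (fun _ => 0) s₁ s₂ m n' := by
  rw [maximalDater_zero_le_iff hs₁ hmn]
  intro q hq hq'
  have h₁ := (maximalDater_zero_le_iff hs₁ (hmn.trans h) _).1
    (le_refl (maximalDater (fun _ => 0) s₁ s₂ m n')) q hq (hq'.trans h)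
  have h₂ : ∑ k ∈ Finset.Icc q n, s₂ k ≤ ∑ k ∈ Finset.Icc q n', s₂ k :=
    Finset.sum_le_sum_of_subset_of_nonneg (Finset.Icc_subset_Icc_right h) fun _ _ _ => hs₂ _
  linarith

lemma exists_maximalDater_zero_eq {s₁ s₂ : ℤ → ℝ} (hs₁ : ∀ k, 0 ≤ s₁ k) {m n : ℤ} (hmn : m ≤ n) :
    ∃ q ∈ Finset.Icc m n, maximalDater (fun _ => 0) s₁ s₂ m n =
      ∑ k ∈ Finset.Icc m q, s₁ k + ∑ k ∈ Finset.Icc q n, s₂ k := by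
  obtain ⟨q, hq, hmax⟩ := Finset.exists_max_image (Finset.Icc m n)
    (fun q => ∑ k ∈ Finset.Icc m q, s₁ k + ∑ k ∈ Finset.Icc q n, s₂ k)
    (Finset.nonempty_Icc.2 hmn)
  refine ⟨q, hq, le_antisymm ?_ ?_⟩
  · rw [maximalDater_zero_le_iff hs₁ hmn]
    exact fun q' h₁ h₂ => hmax q' (Finset.mem_Icc.2 ⟨h₁, h₂⟩)
  · rw [Finset.mem_Icc] at hq
    exact (maximalDater_zero_le_iff hs₁ hmn _).1 le_rfl q hq.1 hq.2

lemma measurable_departure₁ (m : ℤ) (j : ℕ) :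
    Measurable fun s : ℤ → ℝ × ℝ => departure₁ (fun _ => 0) (fun k => (s k).1) m j := by
  induction j with
  | zero => simp only [departure₁]; fun_prop
  | succ j ih => simp only [departure₁]; fun_prop

lemma measurable_departure₂ (m : ℤ) (j : ℕ) :
    Measurable fun s : ℤ → ℝ × ℝ =>
      departure₂ (fun _ => 0) (fun k => (s k).1) (fun k => (s k).2) m j := by
  induction j with
  | zero => have := measurable_departure₁ m 0; simp only [departure₂]; fun_prop
  | succ j ih => have := measurable_departure₁ m (j + 1); simp only [departure₂]; fun_prop

lemma measurable_maximalDater_zero (m n : ℤ) :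
    Measurable fun s : ℤ → ℝ × ℝ =>
      maximalDater (fun _ => 0) (fun k => (s k).1) (fun k => (s k).2) m n := by
  simp only [maximalDater, lastActivity]
  exact (measurable_departure₂ m _).sub_const _

/-- The summands are kept in the form `T (k + 1) - T k` with `k = -i - 1`, to match the
inter-arrival sequence syntactically. -/
lemma sub_eq_sum_increments (T : ℤ → ℝ) (n : ℕ) :
    T 0 - T (-(n : ℤ)) = ∑ i ∈ Finset.range n, (T (-(i : ℤ) - 1 + 1) - T (-(i : ℤ) - 1)) := by
  have := Finset.sum_range_sub' (fun i : ℕ => T (-(i : ℤ))) n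
  simp only [Nat.cast_zero, neg_zero] at this
  rw [← this]
  refine Finset.sum_congr rfl fun i _ => ?_
  rw [sub_add_cancel]
  push_cast
  rw [neg_add']

/-! ### Exponential decay on the logarithmic scale -/

lemma inv_mul_log_ofReal_exp {x : ℝ} (hx : 0 < x) (c : ℝ) :
    ((1 / x : ℝ) : EReal) * ENNReal.log (ENNReal.ofReal (Real.exp (c * x))) = c := by
  rw [ENNReal.log_ofReal_of_pos (Real.exp_pos _), Real.log_exp, ← EReal.coe_mul]
  congr 1
  field_simp

lemma strictMono_inv_mul_log {x : ℝ} (hx : 0 < x) :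
    StrictMono fun u : ℝ≥0∞ => ((1 / x : ℝ) : EReal) * ENNReal.log u := by
  have h : (fun u : ℝ≥0∞ => ((1 / x : ℝ) : EReal) * ENNReal.log u) =
      fun u => ENNReal.log u / (x : EReal) := by
    funext u
    rw [mul_comm, one_div, EReal.coe_inv]
    rfl
  rw [h]
  exact (EReal.strictMono_div_right_of_pos (EReal.coe_pos.2 hx) (EReal.coe_ne_top _)).comp
    ENNReal.log_strictMono

/-- The value `c` is itself the scaled logarithm of `exp (c * x)`, and scaled logarithms are
strictly monotone; `u = 0` and `u = ∞` need no separate treatment. -/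
lemma inv_mul_log_le_iff {x : ℝ} (hx : 0 < x) {c : ℝ} {u : ℝ≥0∞} :
    ((1 / x : ℝ) : EReal) * ENNReal.log u ≤ c ↔ u ≤ ENNReal.ofReal (Real.exp (c * x)) := by
  nth_rw 1 [← inv_mul_log_ofReal_exp hx c]
  exact (strictMono_inv_mul_log hx).le_iff_le

lemma le_inv_mul_log_iff {x : ℝ} (hx : 0 < x) {c : ℝ} {u : ℝ≥0∞} :
    (c : EReal) ≤ ((1 / x : ℝ) : EReal) * ENNReal.log u ↔ ENNReal.ofReal (Real.exp (c * x)) ≤ u := by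
  nth_rw 1 [← inv_mul_log_ofReal_exp hx c]
  exact (strictMono_inv_mul_log hx).le_iff_le

lemma eventually_le_exp_of_limsup_lt {u : ℕ → ℝ≥0∞} {c : ℝ}
    (h : limsup (fun n : ℕ => ((1 / (n : ℝ) : ℝ) : EReal) * ENNReal.log (u n)) atTop < c) :
    ∀ᶠ n : ℕ in atTop, u n ≤ ENNReal.ofReal (Real.exp (c * n)) := by
  filter_upwards [eventually_lt_of_limsup_lt h, eventually_gt_atTop 0] with n hn hn'
  exact (inv_mul_log_le_iff (Nat.cast_pos.2 hn')).1 hn.le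

lemma limsup_le_of_eventually_le_exp {u : ℕ → ℝ≥0∞} {c : ℝ}
    (h : ∀ᶠ n : ℕ in atTop, u n ≤ ENNReal.ofReal (Real.exp (c * n))) :
    limsup (fun n : ℕ => ((1 / (n : ℝ) : ℝ) : EReal) * ENNReal.log (u n)) atTop ≤ c := by
  refine limsup_le_of_le (by isBoundedDefault) ?_
  filter_upwards [h, eventually_gt_atTop 0] with n hn hn'
  exact (inv_mul_log_le_iff (Nat.cast_pos.2 hn')).2 hn

lemma eventually_exp_le_of_lt_liminf {u : ℕ → ℝ≥0∞} {c : ℝ}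
    (h : c < liminf (fun n : ℕ => ((1 / (n : ℝ) : ℝ) : EReal) * ENNReal.log (u n)) atTop) :
    ∀ᶠ n : ℕ in atTop, ENNReal.ofReal (Real.exp (c * n)) ≤ u n := by
  filter_upwards [eventually_lt_of_lt_liminf h, eventually_gt_atTop 0] with n hn hn'
  exact (le_inv_mul_log_iff (Nat.cast_pos.2 hn')).1 hn.le

lemma eventually_const_le_exp_mul (C : ℝ) {η : ℝ} (hη : 0 < η) :
    ∀ᶠ x : ℝ in atTop, C ≤ Real.exp (η * x) :=
  (Real.tendsto_exp_atTop.comp (tendsto_id.const_mul_atTop hη)).eventually_ge_atTop C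

lemma eventually_const_mul_exp_le (C : ℝ) {c d : ℝ} (h : c < d) :
    ∀ᶠ x : ℝ in atTop, C * Real.exp (c * x) ≤ Real.exp (d * x) := by
  filter_upwards [eventually_const_le_exp_mul C (sub_pos.2 h)] with x hx
  calc C * Real.exp (c * x) ≤ Real.exp ((d - c) * x) * Real.exp (c * x) := by gcongr
    _ = Real.exp (d * x) := by rw [← Real.exp_add]; ring_nf

lemma eventually_nat_mul_exp_le {C : ℝ} (hC : 0 ≤ C) {c d : ℝ} (h : c < d) :
    ∀ᶠ n : ℕ in atTop, n * (C * Real.exp (c * n)) ≤ Real.exp (d * n) := by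
  obtain ⟨e, hce, hed⟩ := exists_between h
  have h₁ := tendsto_natCast_atTop_atTop.eventually
    (eventually_const_mul_exp_le (C / (e - c)) hed)
  filter_upwards [h₁] with n hn
  have hpos : 0 < e - c := sub_pos.2 hce
  -- The linear factor is absorbed by `t ≤ exp t` at `t = (e - c) * n`, using half of the gap
  -- between `c` and `d`.
  have hn' : (n : ℝ) ≤ Real.exp ((e - c) * n) / (e - c) := by
    rw [le_div_iff₀ hpos, mul_comm]
    linarith [Real.add_one_le_exp ((e - c) * n)]
  calc (n : ℝ) * (C * Real.exp (c * n))
      ≤ Real.exp ((e - c) * n) / (e - c) * (C * Real.exp (c * n)) := by gcongr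
    _ = C / (e - c) * (Real.exp ((e - c) * n) * Real.exp (c * n)) := by ring
    _ = C / (e - c) * Real.exp (e * n) := by rw [← Real.exp_add]; ring_nf
    _ ≤ Real.exp (d * n) := hn

/-! ### Exponential moments of `Y_n` -/

/-- The stochastic assumptions on the arrival epochs and the service times. -/
structure IsInput {Ω : Type*} [MeasurableSpace Ω] (P : Measure Ω) (T σ₁ σ₂ : ℤ → Ω → ℝ) :
    Prop where
  measurable_τ : ∀ n, Measurable fun ω => T (n + 1) ω - T n ω
  τ_nonneg : ∀ n, ∀ᵐ ω ∂P, 0 ≤ T (n + 1) ω - T n ω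
  iIndepFun_τ : iIndepFun (fun (n : ℤ) ω => T (n + 1) ω - T n ω) P
  identDistrib_τ : ∀ n : ℤ,
    IdentDistrib (fun ω => T (n + 1) ω - T n ω) (fun ω => T 1 ω - T 0 ω) P P
  measurable_σ₁ : ∀ n, Measurable (σ₁ n)
  measurable_σ₂ : ∀ n, Measurable (σ₂ n)
  σ₁_nonneg : ∀ n, ∀ᵐ ω ∂P, 0 ≤ σ₁ n ω
  σ₂_nonneg : ∀ n, ∀ᵐ ω ∂P, 0 ≤ σ₂ n ω
  iIndepFun_σ : iIndepFun (fun (n : ℤ) ω => (σ₁ n ω, σ₂ n ω)) P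
  identDistrib_σ : ∀ n : ℤ,
    IdentDistrib (fun ω => (σ₁ n ω, σ₂ n ω)) (fun ω => (σ₁ 0 ω, σ₂ 0 ω)) P P
  indepFun : IndepFun (fun ω (n : ℤ) => T (n + 1) ω - T n ω)
    (fun ω (n : ℤ) => (σ₁ n ω, σ₂ n ω)) P

/-- The moment generating function with values in `[0, ∞]`. -/
noncomputable def emgf {Ω : Type*} [MeasurableSpace Ω] (P : Measure Ω) (X : Ω → ℝ) (θ : ℝ) :
    ℝ≥0∞ :=
  ∫⁻ ω, ENNReal.ofReal (Real.exp (θ * X ω)) ∂P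

variable {Ω : Type*} [MeasurableSpace Ω] {P : Measure Ω} {T σ₁ σ₂ : ℤ → Ω → ℝ} {θ : ℝ}

/-- `Z_{[m,n]}` for the degenerate arrival process, as a random variable. -/
noncomputable def freeDater (σ₁ σ₂ : ℤ → Ω → ℝ) (m n : ℤ) (ω : Ω) : ℝ :=
  maximalDater (fun _ => 0) (fun k => σ₁ k ω) (fun k => σ₂ k ω) m n

/-- `Y_n` as a random variable. -/
noncomputable def randomY (T σ₁ σ₂ : ℤ → Ω → ℝ) (n : ℕ) (ω : Ω) : ℝ :=
  pathY (fun k => T k ω) (fun k => σ₁ k ω) (fun k => σ₂ k ω) n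

lemma emgf_congr {X Y : Ω → ℝ} (h : X =ᵐ[P] Y) (θ : ℝ) : emgf P X θ = emgf P Y θ :=
  lintegral_congr_ae (h.mono fun ω hω => by simp only [hω])

lemma emgf_mono {X Y : Ω → ℝ} (h : X ≤ᵐ[P] Y) (hθ : 0 ≤ θ) : emgf P X θ ≤ emgf P Y θ :=
  lintegral_mono_ae (h.mono fun ω hω => by gcongr)

lemma emgf_identDistrib {X Y : Ω → ℝ} (h : IdentDistrib X Y P P) (θ : ℝ) :
    emgf P X θ = emgf P Y θ :=
  (h.comp (u := fun x => ENNReal.ofReal (Real.exp (θ * x))) (by fun_prop)).lintegral_eq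

lemma emgf_ne_zero [IsProbabilityMeasure P] {X : Ω → ℝ} (hX : Measurable X) :
    emgf P X θ ≠ 0 := by
  rw [emgf, ne_eq, lintegral_eq_zero_iff (by fun_prop)]
  intro h0
  obtain ⟨ω, hω⟩ := h0.exists
  simp only [Pi.zero_apply, ENNReal.ofReal_eq_zero] at hω
  exact absurd hω (not_le.2 (Real.exp_pos _))

lemma emgf_le_one [IsProbabilityMeasure P] {X : Ω → ℝ} (hX : ∀ᵐ ω ∂P, θ * X ω ≤ 0) :
    emgf P X θ ≤ 1 := by
  calc emgf P X θ ≤ ∫⁻ _, 1 ∂P := lintegral_mono_ae (hX.mono fun ω hω => by simpa using hω)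
    _ = 1 := by simp

lemma emgf_sum {ι : Type*} {X : ι → Ω → ℝ} (hX : iIndepFun X P) (hm : ∀ i, Measurable (X i))
    (s : Finset ι) (θ : ℝ) : emgf P (fun ω => ∑ i ∈ s, X i ω) θ = ∏ i ∈ s, emgf P (X i) θ := by
  have h := lintegral_prod_eq_prod_lintegral_of_indepFun s
    (fun i ω => ENNReal.ofReal (Real.exp (θ * X i ω)))
    (hX.comp (fun _ x => ENNReal.ofReal (Real.exp (θ * x))) fun _ => by fun_prop)
    fun i => by have := hm i; fun_prop
  simp only [emgf, ← h, Finset.mul_sum, Real.exp_sum]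
  congr with ω
  rw [ENNReal.ofReal_prod_of_nonneg fun _ _ => (Real.exp_pos _).le]

lemma emgf_add {X Y : Ω → ℝ} (h : IndepFun X Y P) (hX : Measurable X) (hY : Measurable Y) (θ : ℝ) :
    emgf P (fun ω => X ω + Y ω) θ = emgf P X θ * emgf P Y θ := by
  have h' := lintegral_mul_eq_lintegral_mul_lintegral_of_indepFun
    (f := fun ω => ENNReal.ofReal (Real.exp (θ * X ω)))
    (g := fun ω => ENNReal.ofReal (Real.exp (θ * Y ω))) (μ := P) (by fun_prop) (by fun_prop)
    (h.comp (φ := fun x => ENNReal.ofReal (Real.exp (θ * x)))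
      (ψ := fun x => ENNReal.ofReal (Real.exp (θ * x))) (by fun_prop) (by fun_prop))
  rw [emgf, emgf, emgf, ← h']
  congr with ω
  rw [Pi.mul_apply, ← ENNReal.ofReal_mul (Real.exp_pos _).le, ← Real.exp_add, mul_add]

lemma measure_lt_le_emgf {X : Ω → ℝ} (hX : AEMeasurable X P) (hθ : 0 ≤ θ) (x : ℝ) :
    P {ω | x < X ω} ≤ ENNReal.ofReal (Real.exp (-θ * x)) * emgf P X θ := by
  have h₁ : P {ω | x < X ω} ≤
      P {ω | ENNReal.ofReal (Real.exp (θ * x)) ≤ ENNReal.ofReal (Real.exp (θ * X ω))} :=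
    measure_mono fun ω (hω : x < X ω) => ENNReal.ofReal_le_ofReal <| Real.exp_le_exp.2 <|
      mul_le_mul_of_nonneg_left hω.le hθ
  have h₂ := mul_meas_ge_le_lintegral₀ (μ := P)
    (f := fun ω => ENNReal.ofReal (Real.exp (θ * X ω))) (by fun_prop)
    (ENNReal.ofReal (Real.exp (θ * x)))
  calc P {ω | x < X ω}
      = ENNReal.ofReal (Real.exp (-θ * x)) *
          (ENNReal.ofReal (Real.exp (θ * x)) * P {ω | x < X ω}) := by
        rw [← mul_assoc, ← ENNReal.ofReal_mul (Real.exp_pos _).le, ← Real.exp_add]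
        simp
    _ ≤ _ := by
        gcongr
        exact le_trans (by gcongr) h₂

lemma LambdaT_eq {l : ℝ}
    (hl : emgf P (fun ω => T 1 ω - T 0 ω) (-θ) = ENNReal.ofReal (Real.exp l)) :
    LambdaT P T (-θ) = l := by
  rw [emgf] at hl
  rw [LambdaT, logMgf, hl, ENNReal.log_ofReal_of_pos (Real.exp_pos _), Real.log_exp]

lemma ofReal_exp_pow (l : ℝ) (n : ℕ) :
    ENNReal.ofReal (Real.exp l) ^ n = ENNReal.ofReal (Real.exp (l * n)) := by
  rw [← ENNReal.ofReal_pow (Real.exp_pos _).le, ← Real.exp_nat_mul, mul_comm]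

namespace IsInput

variable (h : IsInput P T σ₁ σ₂)
include h

lemma measurable_freeDater (m n : ℤ) : Measurable (freeDater σ₁ σ₂ m n) :=
  (measurable_maximalDater_zero m n).comp
    (measurable_pi_lambda _ fun k => (h.measurable_σ₁ k).prodMk (h.measurable_σ₂ k))

lemma ae_σ₁_nonneg : ∀ᵐ ω ∂P, ∀ k, 0 ≤ σ₁ k ω := ae_all_iff.2 h.σ₁_nonneg

lemma ae_σ₂_nonneg : ∀ᵐ ω ∂P, ∀ k, 0 ≤ σ₂ k ω := ae_all_iff.2 h.σ₂_nonneg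

/-- The joint law of an i.i.d. sequence is a product law, hence shift invariant, and the dater is a
measurable function of the sequence. -/
lemma identDistrib_freeDater (a m n : ℤ) :
    IdentDistrib (freeDater σ₁ σ₂ (m + a) (n + a)) (freeDater σ₁ σ₂ m n) P P := by
  have hind : iIndepFun (fun (k : ℤ) ω => (σ₁ (k + a) ω, σ₂ (k + a) ω)) P :=
    h.iIndepFun_σ.precomp (add_left_injective a)
  have hpi := IdentDistrib.pi
    (fun k => (h.identDistrib_σ (k + a)).trans (h.identDistrib_σ k).symm) hind h.iIndepFun_σ
  have := hpi.comp (measurable_maximalDater_zero m n)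
  convert this using 1
  · funext ω
    exact maximalDater_zero_shift _ _ _ _ _
  · rfl

lemma emgf_neg_elapsed (n : ℕ) (θ : ℝ) :
    emgf P (fun ω => -(T 0 ω - T (-(n : ℤ)) ω)) θ = emgf P (fun ω => T 1 ω - T 0 ω) (-θ) ^ n := by
  have hinj : Function.Injective fun i : ℕ => -(i : ℤ) - 1 := fun i j hij => by
    simpa using hij
  have hsum := emgf_sum (h.iIndepFun_τ.precomp hinj) (fun i => h.measurable_τ _)
    (Finset.range n) (-θ)
  have hval : ∀ i : ℕ, emgf P (fun ω => T (-(i : ℤ) - 1 + 1) ω - T (-(i : ℤ) - 1) ω) (-θ) =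
      emgf P (fun ω => T 1 ω - T 0 ω) (-θ) := fun i => emgf_identDistrib (h.identDistrib_τ _) _
  simp only [hval, Finset.prod_const, Finset.card_range] at hsum
  rw [← hsum]
  unfold emgf
  congr with ω
  have := sub_eq_sum_increments (fun k => T k ω) n
  simp only at this ⊢
  rw [this, neg_mul, mul_neg]

lemma measurable_elapsed (n : ℕ) : Measurable fun ω => T 0 ω - T (-(n : ℤ)) ω := by
  have : (fun ω => T 0 ω - T (-(n : ℤ)) ω) = fun ω =>
      ∑ i ∈ Finset.range n, (T (-(i : ℤ) - 1 + 1) ω - T (-(i : ℤ) - 1) ω) :=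
    funext fun ω => sub_eq_sum_increments (fun k => T k ω) n
  rw [this]
  exact Finset.measurable_sum _ fun i _ => h.measurable_τ _

lemma randomY_ae_eq (n : ℕ) : randomY T σ₁ σ₂ n =ᵐ[P]
    fun ω => freeDater σ₁ σ₂ (-(n : ℤ)) 0 ω + -(T 0 ω - T (-(n : ℤ)) ω) := by
  filter_upwards [h.ae_σ₁_nonneg] with ω hω
  rw [randomY, pathY_eq _ _ hω, freeDater, sub_eq_add_neg]

lemma aemeasurable_randomY (n : ℕ) : AEMeasurable (randomY T σ₁ σ₂ n) P :=
  ⟨_, (h.measurable_freeDater _ _).add (h.measurable_elapsed n).neg, h.randomY_ae_eq n⟩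

lemma indepFun_freeDater_elapsed (n : ℕ) : IndepFun (freeDater σ₁ σ₂ (-(n : ℤ)) 0)
    (fun ω => -(T 0 ω - T (-(n : ℤ)) ω)) P := by
  have h₁ : Measurable fun t : ℤ → ℝ => -∑ i ∈ Finset.range n, t (-(i : ℤ) - 1) := by fun_prop
  have h₂ := (h.indepFun.comp h₁ (measurable_maximalDater_zero (-(n : ℤ)) 0)).symm
  convert h₂ using 1
  · rfl
  · funext ω
    have := sub_eq_sum_increments (fun k => T k ω) n
    simp only [Function.comp_apply] at this ⊢
    rw [this]

/-- The exponential moments of `Y_n` factorize. -/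
lemma emgf_randomY (n : ℕ) (θ : ℝ) : emgf P (randomY T σ₁ σ₂ n) θ =
    emgf P (freeDater σ₁ σ₂ 1 (n + 1 : ℕ)) θ * emgf P (fun ω => T 1 ω - T 0 ω) (-θ) ^ n := by
  rw [emgf_congr (h.randomY_ae_eq n), emgf_add (h.indepFun_freeDater_elapsed n)
    (h.measurable_freeDater _ _) (h.measurable_elapsed n).neg, h.emgf_neg_elapsed]
  congr 1
  -- Customers `-n, …, 0` number `n + 1`, so the shift lands on `[1, n + 1]`; only `n` inter-arrival
  -- times separate them.
  have := h.identDistrib_freeDater (-(n + 1 : ℤ)) 1 (n + 1 : ℕ)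
  rw [← emgf_identDistrib this]
  congr <;> push_cast <;> ring

lemma emgf_freeDater_mono (hθ : 0 ≤ θ) {m n : ℕ} (hm : 1 ≤ m) (hmn : m ≤ n) :
    emgf P (freeDater σ₁ σ₂ 1 m) θ ≤ emgf P (freeDater σ₁ σ₂ 1 n) θ := by
  refine emgf_mono ?_ hθ
  filter_upwards [h.ae_σ₁_nonneg, h.ae_σ₂_nonneg] with ω h₁ h₂
  exact maximalDater_zero_mono h₁ h₂ (by exact_mod_cast hm) (by exact_mod_cast hmn)

/-- The Laplace transform lies in `(0, 1]`, so its logarithm is real and can be moved across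
inequalities in `EReal`. -/
lemma exists_emgf_interarrival_eq [IsProbabilityMeasure P] (hθ : 0 ≤ θ) :
    ∃ l ≤ 0, emgf P (fun ω => T 1 ω - T 0 ω) (-θ) = ENNReal.ofReal (Real.exp l) := by
  have h0 : emgf P (fun ω => T 1 ω - T 0 ω) (-θ) ≠ 0 :=
    emgf_ne_zero (by simpa using h.measurable_τ 0)
  have h1 : emgf P (fun ω => T 1 ω - T 0 ω) (-θ) ≤ 1 := by
    refine emgf_le_one ?_
    filter_upwards [h.τ_nonneg 0] with ω hω
    rw [zero_add] at hω
    nlinarith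
  have htop := ne_top_of_le_ne_top ENNReal.one_ne_top h1
  have hpos := ENNReal.toReal_pos h0 htop
  refine ⟨Real.log (emgf P (fun ω => T 1 ω - T 0 ω) (-θ)).toReal, ?_, ?_⟩
  · exact Real.log_nonpos hpos.le (ENNReal.toReal_le_of_le_ofReal zero_le_one (by simpa using h1))
  · rw [Real.exp_log hpos, ENNReal.ofReal_toReal htop]

lemma eventually_emgf_randomY_le [IsProbabilityMeasure P] (hθ : 0 ≤ θ) {c : ℝ}
    (hc : LambdaT P T (-θ) + LambdaZ P σ₁ σ₂ θ < c) :
    ∀ᶠ n : ℕ in atTop, emgf P (randomY T σ₁ σ₂ n) θ ≤ ENNReal.ofReal (Real.exp (c * n)) := by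
  obtain ⟨l, -, hl⟩ := h.exists_emgf_interarrival_eq hθ
  rw [LambdaT_eq hl] at hc
  have hc' : LambdaZ P σ₁ σ₂ θ < (c - l : ℝ) := by
    by_contra! hcon
    refine hc.not_ge ?_
    calc (c : EReal) = (l : EReal) + (c - l : ℝ) := by rw [← EReal.coe_add]; congr 1; ring
      _ ≤ _ := by gcongr
  obtain ⟨L, hL, hLc⟩ := EReal.lt_iff_exists_real_btwn.1 hc'
  rw [EReal.coe_lt_coe_iff] at hLc
  -- The extra customer costs a constant factor `exp L`, absorbed by the gap `L + l < c`.
  have hev := (tendsto_add_atTop_nat 1).eventually (eventually_le_exp_of_limsup_lt hL)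
  filter_upwards [hev, tendsto_natCast_atTop_atTop.eventually
    (eventually_const_mul_exp_le (Real.exp L) (by linarith : L + l < c))] with n hn hn'
  rw [h.emgf_randomY n θ, hl, ofReal_exp_pow]
  calc _ ≤ ENNReal.ofReal (Real.exp (L * (n + 1 : ℕ))) * ENNReal.ofReal (Real.exp (l * n)) := by
        gcongr
        exact hn
    _ = ENNReal.ofReal (Real.exp L * Real.exp ((L + l) * n)) := by
        rw [← ENNReal.ofReal_mul (Real.exp_pos _).le, ← Real.exp_add, ← Real.exp_add]
        push_cast
        ring_nf
    _ ≤ _ := ENNReal.ofReal_le_ofReal hn'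

lemma LambdaT_add_LambdaZ_le [IsProbabilityMeasure P] (hθ : 0 ≤ θ) {c : ℝ}
    (hc : ∀ᶠ n : ℕ in atTop,
      emgf P (randomY T σ₁ σ₂ n) θ ≤ ENNReal.ofReal (Real.exp (c * n))) :
    LambdaT P T (-θ) + LambdaZ P σ₁ σ₂ θ ≤ c := by
  obtain ⟨l, -, hl⟩ := h.exists_emgf_interarrival_eq hθ
  rw [LambdaT_eq hl]
  have hfree : ∀ᶠ n : ℕ in atTop, emgf P (freeDater σ₁ σ₂ 1 (n + 1 : ℕ)) θ ≤
      ENNReal.ofReal (Real.exp ((c - l) * n)) := by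
    filter_upwards [hc] with n hn
    rw [h.emgf_randomY, hl, ofReal_exp_pow] at hn
    calc _ = emgf P (freeDater σ₁ σ₂ 1 (n + 1 : ℕ)) θ *
          (ENNReal.ofReal (Real.exp (l * n)) * ENNReal.ofReal (Real.exp (-(l * n)))) := by
          rw [← ENNReal.ofReal_mul (Real.exp_pos _).le, ← Real.exp_add]
          simp
      _ ≤ ENNReal.ofReal (Real.exp (c * n)) * ENNReal.ofReal (Real.exp (-(l * n))) := by
          rw [← mul_assoc]
          gcongr
      _ = _ := by
          rw [← ENNReal.ofReal_mul (Real.exp_pos _).le, ← Real.exp_add]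
          ring_nf
  have hZ : LambdaZ P σ₁ σ₂ θ ≤ (c - l : ℝ) := by
    refine EReal.le_of_forall_lt_iff_le.1 fun d hd => ?_
    rw [EReal.coe_lt_coe_iff] at hd
    refine limsup_le_of_eventually_le_exp ?_
    rw [← map_add_atTop_eq_nat 1, eventually_map]
    filter_upwards [hfree, tendsto_natCast_atTop_atTop.eventually
      (eventually_const_mul_exp_le (Real.exp (-d)) hd)] with n hn hn'
    refine hn.trans (ENNReal.ofReal_le_ofReal ?_)
    calc Real.exp ((c - l) * n) = Real.exp d * (Real.exp (-d) * Real.exp ((c - l) * n)) := by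
          rw [← mul_assoc, ← Real.exp_add]
          simp
      _ ≤ Real.exp d * Real.exp (d * n) := by gcongr
      _ = Real.exp (d * (n + 1 : ℕ)) := by
          rw [← Real.exp_add]
          push_cast
          ring_nf
  calc (l : EReal) + LambdaZ P σ₁ σ₂ θ ≤ (l : EReal) + (c - l : ℝ) := by gcongr
    _ = c := by rw [← EReal.coe_add]; congr 1; ring

/-- The dater is monotone in the number of customers, so finiteness for one large index passes to
all smaller ones. -/
lemma emgf_randomY_lt_top [IsProbabilityMeasure P] (hθ : 0 ≤ θ) {c : ℝ}
    (hc : ∀ᶠ n : ℕ in atTop,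
      emgf P (randomY T σ₁ σ₂ n) θ ≤ ENNReal.ofReal (Real.exp (c * n))) (n : ℕ) :
    emgf P (randomY T σ₁ σ₂ n) θ < ∞ := by
  obtain ⟨l, -, hl⟩ := h.exists_emgf_interarrival_eq hθ
  obtain ⟨N, hN, hnN⟩ := (hc.and (eventually_ge_atTop n)).exists
  have hfin : emgf P (freeDater σ₁ σ₂ 1 (N + 1 : ℕ)) θ ≠ ∞ := by
    intro htop
    rw [h.emgf_randomY, hl, ofReal_exp_pow, htop, ENNReal.top_mul (by simp [Real.exp_pos])] at hN
    exact absurd hN (by simp)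
  rw [h.emgf_randomY, hl, ofReal_exp_pow]
  exact ENNReal.mul_lt_top ((h.emgf_freeDater_mono hθ (by omega) (by omega)).trans_lt
    hfin.lt_top) ENNReal.ofReal_lt_top

end IsInput

/-! ### Stability makes the limiting logarithmic moment generating function negative near zero -/

/-- The maximum over paths is bounded by the sum over the `n` switching customers `q`. Along a fixed
path the contributions of the customers are independent, and only customer `q` contributes both
services, hence a single factor `C`. -/
lemma IsInput.emgf_freeDater_le (h : IsInput P T σ₁ σ₂) {f C : ℝ} (hf : 0 ≤ f)
    (h₁ : emgf P (σ₁ 0) θ ≤ ENNReal.ofReal (Real.exp f))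
    (h₂ : emgf P (σ₂ 0) θ ≤ ENNReal.ofReal (Real.exp f))
    (h₁₂ : emgf P (fun ω => σ₁ 0 ω + σ₂ 0 ω) θ ≤ ENNReal.ofReal C) {n : ℕ} (hn : 1 ≤ n) :
    emgf P (freeDater σ₁ σ₂ 1 n) θ ≤ ENNReal.ofReal (n * (C * Real.exp (f * n))) := by
  set g : ℤ → ℤ → ℝ × ℝ → ℝ := fun q k s =>
    (if k ≤ q then s.1 else 0) + (if q ≤ k then s.2 else 0) with hg
  have hgm : ∀ q k, Measurable (g q k) := fun q k => by
    simp only [hg]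
    split_ifs <;> fun_prop
  have hsm : ∀ k, Measurable fun ω => (σ₁ k ω, σ₂ k ω) := fun k =>
    (h.measurable_σ₁ k).prodMk (h.measurable_σ₂ k)
  have hterm : ∀ q k, emgf P (fun ω => g q k (σ₁ k ω, σ₂ k ω)) θ ≤
      ENNReal.ofReal (Real.exp f) * (if k = q then ENNReal.ofReal C else 1) := by
    intro q k
    have hid := (h.identDistrib_σ k).comp (hgm q k)
    rw [emgf_identDistrib (X := fun ω => g q k (σ₁ k ω, σ₂ k ω)) hid]
    rcases lt_trichotomy k q with hkq | rfl | hkq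
    · simpa [hg, hkq.le, hkq.not_ge, hkq.ne, Function.comp_def] using h₁
    -- The factor `exp f` is also granted to customer `q`, to make the product uniform; this is
    -- where `0 ≤ f` enters.
    · have : (1 : ℝ≥0∞) ≤ ENNReal.ofReal (Real.exp f) := by simpa using hf
      simp only [hg, Function.comp_def, le_refl, if_true]
      exact h₁₂.trans (le_mul_of_one_le_left' this)
    · simpa [hg, hkq.le, hkq.not_ge, hkq.ne', Function.comp_def] using h₂
  have hprod : ∀ q ∈ Finset.Icc (1 : ℤ) n,
      emgf P (fun ω => ∑ k ∈ Finset.Icc (1 : ℤ) n, g q k (σ₁ k ω, σ₂ k ω)) θ ≤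
        ENNReal.ofReal (Real.exp (f * n)) * ENNReal.ofReal C := by
    intro q hq
    have hsum := emgf_sum (h.iIndepFun_σ.comp (fun k => g q k) (hgm q))
      (fun k => (hgm q k).comp (hsm k)) (Finset.Icc (1 : ℤ) n) θ
    simp only [Function.comp_apply] at hsum
    rw [hsum]
    calc _ ≤ ∏ k ∈ Finset.Icc (1 : ℤ) n,
          (ENNReal.ofReal (Real.exp f) * (if k = q then ENNReal.ofReal C else 1)) :=
          Finset.prod_le_prod' fun k _ => hterm q k
      _ = _ := by
          rw [Finset.prod_mul_distrib, Finset.prod_const, Finset.prod_ite_eq', if_pos hq,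
            Int.card_Icc, add_sub_cancel_right, Int.toNat_natCast, ofReal_exp_pow]
  have hpath : ∀ᵐ ω ∂P, ENNReal.ofReal (Real.exp (θ * freeDater σ₁ σ₂ 1 n ω)) ≤
      ∑ q ∈ Finset.Icc (1 : ℤ) n, ENNReal.ofReal
        (Real.exp (θ * ∑ k ∈ Finset.Icc (1 : ℤ) n, g q k (σ₁ k ω, σ₂ k ω))) := by
    filter_upwards [h.ae_σ₁_nonneg] with ω hω
    obtain ⟨q, hq, hqeq⟩ := exists_maximalDater_zero_eq (s₂ := fun k => σ₂ k ω) hω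
      (show (1 : ℤ) ≤ n by exact_mod_cast hn)
    have hval : freeDater σ₁ σ₂ 1 n ω =
        ∑ k ∈ Finset.Icc (1 : ℤ) n, g q k (σ₁ k ω, σ₂ k ω) := by
      rw [freeDater, hqeq]
      rw [Finset.mem_Icc] at hq
      simp only [hg, Finset.sum_add_distrib, ← Finset.sum_filter]
      congr 1
      · refine Finset.sum_congr ?_ fun _ _ => rfl
        ext k; simp only [Finset.mem_Icc, Finset.mem_filter]; omega
      · refine Finset.sum_congr ?_ fun _ _ => rfl
        ext k; simp only [Finset.mem_Icc, Finset.mem_filter]; omega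
    rw [hval]
    exact Finset.single_le_sum (f := fun q => ENNReal.ofReal
      (Real.exp (θ * ∑ k ∈ Finset.Icc (1 : ℤ) n, g q k (σ₁ k ω, σ₂ k ω))))
      (fun _ _ => zero_le) hq
  calc emgf P (freeDater σ₁ σ₂ 1 n) θ
      ≤ ∑ q ∈ Finset.Icc (1 : ℤ) n,
          emgf P (fun ω => ∑ k ∈ Finset.Icc (1 : ℤ) n, g q k (σ₁ k ω, σ₂ k ω)) θ := by
        refine (lintegral_mono_ae hpath).trans_eq (lintegral_finsetSum _ fun q _ => ?_)
        have : Measurable fun ω => ∑ k ∈ Finset.Icc (1 : ℤ) n, g q k (σ₁ k ω, σ₂ k ω) :=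
          Finset.measurable_sum _ fun k _ => (hgm q k).comp (hsm k)
        fun_prop
    _ ≤ ∑ q ∈ Finset.Icc (1 : ℤ) n, ENNReal.ofReal (Real.exp (f * n)) * ENNReal.ofReal C :=
        Finset.sum_le_sum hprod
    _ = ENNReal.ofReal (n * (C * Real.exp (f * n))) := by
        rw [Finset.sum_const, Int.card_Icc, add_sub_cancel_right, Int.toNat_natCast,
          nsmul_eq_mul, ENNReal.ofReal_mul (by positivity), ENNReal.ofReal_natCast, mul_comm C,
          ENNReal.ofReal_mul (Real.exp_pos _).le]

lemma IsInput.LambdaZ_le (h : IsInput P T σ₁ σ₂) {f C d : ℝ} (hf : 0 ≤ f)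
    (h₁ : emgf P (σ₁ 0) θ ≤ ENNReal.ofReal (Real.exp f))
    (h₂ : emgf P (σ₂ 0) θ ≤ ENNReal.ofReal (Real.exp f)) (hC : 0 ≤ C)
    (h₁₂ : emgf P (fun ω => σ₁ 0 ω + σ₂ 0 ω) θ ≤ ENNReal.ofReal C) (hd : f < d) :
    LambdaZ P σ₁ σ₂ θ ≤ d := by
  refine limsup_le_of_eventually_le_exp ?_
  filter_upwards [eventually_nat_mul_exp_le hC hd, eventually_ge_atTop 1] with n hn hn'
  exact (h.emgf_freeDater_le hf h₁ h₂ h₁₂ hn').trans (ENNReal.ofReal_le_ofReal hn)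

/-- The right derivative at `0` of the Laplace transform of a nonnegative integrable variable. -/
lemma hasDerivWithinAt_integral_exp_neg [IsProbabilityMeasure P] {X : Ω → ℝ} (hX : Integrable X P)
    (h0 : ∀ᵐ ω ∂P, 0 ≤ X ω) :
    HasDerivWithinAt (fun θ => ∫ ω, Real.exp (-θ * X ω) ∂P) (-∫ ω, X ω ∂P) (Set.Ioi 0) 0 := by
  rw [hasDerivWithinAt_iff_tendsto_slope' (by simp), ← integral_neg]
  -- Since `1 - exp (-t) ≤ t`, the difference quotients are dominated by `X` itself.
  have hbound : ∀ θ : ℝ, 0 < θ → ∀ x : ℝ, 0 ≤ x →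
      ‖θ⁻¹ * (Real.exp (-θ * x) - 1)‖ ≤ x := fun θ hθ x hx => by
    have h₁ : Real.exp (-θ * x) ≤ 1 := Real.exp_le_one_iff.2 (by nlinarith)
    have h₂ := Real.add_one_le_exp (-θ * x)
    rw [norm_mul, Real.norm_of_nonneg (by positivity), Real.norm_of_nonpos (by linarith),
      inv_mul_le_iff₀ hθ]
    linarith
  have hlim : Tendsto (fun θ => ∫ ω, θ⁻¹ * (Real.exp (-θ * X ω) - 1) ∂P) (𝓝[>] 0)
      (𝓝 (∫ ω, -X ω ∂P)) := by
    have hXm := hX.aestronglyMeasurable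
    refine tendsto_integral_filter_of_dominated_convergence X ?_ ?_ hX ?_
    · refine .of_forall fun θ => ?_
      have hXm' := hXm.aemeasurable
      exact AEMeasurable.aestronglyMeasurable (by fun_prop)
    · filter_upwards [self_mem_nhdsWithin] with θ hθ
      filter_upwards [h0] with ω hω
      exact hbound θ hθ _ hω
    · refine .of_forall fun ω => ?_
      have hd : HasDerivAt (fun θ : ℝ => Real.exp (-θ * X ω)) (-X ω) 0 := by
        simpa using ((hasDerivAt_id (0 : ℝ)).neg.mul_const (X ω)).exp
      have := (hasDerivWithinAt_iff_tendsto_slope' (s := Set.Ioi 0) (by simp)).1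
        hd.hasDerivWithinAt
      refine this.congr fun θ => ?_
      simp [slope_def_field, div_eq_inv_mul]
  refine hlim.congr' ?_
  filter_upwards [self_mem_nhdsWithin] with θ hθ
  have hint : Integrable (fun ω => Real.exp (-θ * X ω)) P := by
    refine Integrable.mono' (integrable_const (1 : ℝ)) ?_ ?_
    · have := hX.aestronglyMeasurable.aemeasurable
      exact AEMeasurable.aestronglyMeasurable (by fun_prop)
    · filter_upwards [h0] with ω hω
      rw [Real.norm_of_nonneg (Real.exp_pos _).le]
      have : (0 : ℝ) < θ := hθ
      exact Real.exp_le_one_iff.2 (by nlinarith)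
  rw [integral_const_mul, integral_sub hint (integrable_const _)]
  simp [slope_def_field, div_eq_inv_mul]

/-- The product equals `1` at `θ = 0`, where its right derivative is `𝔼 S - 𝔼 X < 0`. -/
lemma eventually_mgf_mul_lt_one [IsProbabilityMeasure P] {S X : Ω → ℝ} (hX : Integrable X P)
    (h0 : ∀ᵐ ω ∂P, 0 ≤ X ω) (hS : 0 ∈ interior (integrableExpSet S P))
    (hlt : ∫ ω, S ω ∂P < ∫ ω, X ω ∂P) :
    ∀ᶠ θ in 𝓝[>] 0, mgf S P θ * ∫ ω, Real.exp (-θ * X ω) ∂P < 1 := by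
  have hd₁ : HasDerivAt (mgf S P) (∫ ω, S ω ∂P) 0 := by simpa using hasDerivAt_mgf hS
  have hd := hd₁.hasDerivWithinAt.mul (hasDerivWithinAt_integral_exp_neg hX h0)
  simp only [mgf_zero', neg_zero, zero_mul, Real.exp_zero, integral_const, probReal_univ,
    smul_eq_mul, mul_one, one_mul] at hd
  rw [hasDerivWithinAt_iff_tendsto_slope' (by simp)] at hd
  filter_upwards [hd.eventually_lt_const (u := 0) (by linarith), self_mem_nhdsWithin] with θ hθ hpos
  have hpos' : (0 : ℝ) < θ := hpos
  rw [slope_def_field, sub_zero, div_neg_iff] at hθ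
  rcases hθ with hθ | hθ
  · linarith
  · have := hθ.1
    simp only [Pi.mul_apply, mgf_zero', neg_zero, zero_mul, Real.exp_zero, integral_const,
      probReal_univ, smul_eq_mul, mul_one] at this
    linarith

lemma emgf_eq_ofReal_mgf {X : Ω → ℝ} (h : Integrable (fun ω => Real.exp (θ * X ω)) P) :
    emgf P X θ = ENNReal.ofReal (mgf X P θ) :=
  (ofReal_integral_eq_lintegral_ofReal h (.of_forall fun _ => (Real.exp_pos _).le)).symm

/-- Under stability and light tails the decay rate is positive. -/
lemma IsInput.exists_LambdaT_add_LambdaZ_lt_zero [IsProbabilityMeasure P]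
    (h : IsInput P T σ₁ σ₂) (hint : Integrable (fun ω => T 1 ω - T 0 ω) P)
    (hlight : ∀ᶠ θ in 𝓝 (0 : ℝ), Integrable (fun ω => Real.exp (θ * (σ₁ 0 ω + σ₂ 0 ω))) P)
    (hstable : max (∫ ω, σ₁ 0 ω ∂P) (∫ ω, σ₂ 0 ω ∂P) < ∫ ω, (T 1 ω - T 0 ω) ∂P) :
    ∃ θ : ℝ, 0 < θ ∧ LambdaT P T (-θ) + LambdaZ P σ₁ σ₂ θ < 0 := by
  have hτ : ∀ᵐ ω ∂P, 0 ≤ T 1 ω - T 0 ω := by simpa using h.τ_nonneg 0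
  -- Each service time is dominated by the sum; passing to `|θ|` covers negative `θ`, needed for `0`
  -- to be interior to the set of integrability.
  have hle : ∀ {S : Ω → ℝ}, Measurable S → (∀ᵐ ω ∂P, |S ω| ≤ σ₁ 0 ω + σ₂ 0 ω) →
      ∀ᶠ θ in 𝓝 (0 : ℝ), Integrable (fun ω => Real.exp (θ * S ω)) P := by
    intro S hS hSle
    have habs : Tendsto (fun θ : ℝ => |θ|) (𝓝 0) (𝓝 0) := by
      simpa using continuous_abs.tendsto (0 : ℝ)
    filter_upwards [habs.eventually hlight] with θ hθ
    refine hθ.mono' (by fun_prop) ?_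
    filter_upwards [hSle] with ω hω
    rw [Real.norm_of_nonneg (Real.exp_pos _).le, Real.exp_le_exp]
    calc θ * S ω ≤ |θ| * |S ω| := (le_abs_self _).trans (abs_mul _ _).le
      _ ≤ _ := by gcongr
  have hi₁ := hle (h.measurable_σ₁ 0) (by
    filter_upwards [h.σ₁_nonneg 0, h.σ₂_nonneg 0] with ω h₁ h₂
    rw [abs_of_nonneg h₁]
    linarith)
  have hi₂ := hle (h.measurable_σ₂ 0) (by
    filter_upwards [h.σ₁_nonneg 0, h.σ₂_nonneg 0] with ω h₁ h₂
    rw [abs_of_nonneg h₂]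
    linarith)
  have he₁ := eventually_mgf_mul_lt_one hint hτ (mem_interior_iff_mem_nhds.2 hi₁)
    ((le_max_left _ _).trans_lt hstable)
  have he₂ := eventually_mgf_mul_lt_one hint hτ (mem_interior_iff_mem_nhds.2 hi₂)
    ((le_max_right _ _).trans_lt hstable)
  obtain ⟨θ, hl₁, hl₂, hs₁, hs₂, hs, hpos⟩ := (he₁.and <| he₂.and <|
    (hi₁.filter_mono nhdsWithin_le_nhds).and <| (hi₂.filter_mono nhdsWithin_le_nhds).and <|
    (hlight.filter_mono nhdsWithin_le_nhds).and self_mem_nhdsWithin).exists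
  have hpos' : (0 : ℝ) < θ := hpos
  refine ⟨θ, hpos', ?_⟩
  obtain ⟨l, -, hl⟩ := h.exists_emgf_interarrival_eq hpos'.le
  have hintτ : Integrable (fun ω => Real.exp (-θ * (T 1 ω - T 0 ω))) P := by
    refine ⟨?_, ?_⟩
    · have := hint.aestronglyMeasurable.aemeasurable
      exact AEMeasurable.aestronglyMeasurable (by fun_prop)
    · rw [hasFiniteIntegral_iff_ofReal (.of_forall fun _ => (Real.exp_pos _).le)]
      exact hl.trans_lt ENNReal.ofReal_lt_top
  have hA : ∫ ω, Real.exp (-θ * (T 1 ω - T 0 ω)) ∂P = Real.exp l := by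
    rw [emgf_eq_ofReal_mgf hintτ] at hl
    exact (ENNReal.ofReal_eq_ofReal_iff mgf_nonneg (Real.exp_pos _).le).1 hl
  rw [hA] at hl₁ hl₂
  -- Makes `log F` nonnegative, as `IsInput.LambdaZ_le` requires.
  have hone : 1 ≤ mgf (σ₁ 0) P θ := by
    have := integral_mono_ae (integrable_const (1 : ℝ)) hs₁ (by
      filter_upwards [h.σ₁_nonneg 0] with ω hω
      exact Real.one_le_exp (by positivity))
    simpa [mgf] using this
  set F := max (mgf (σ₁ 0) P θ) (mgf (σ₂ 0) P θ) with hF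
  have hF1 : 1 ≤ F := hone.trans (le_max_left _ _)
  have hFl : Real.log F < -l := by
    rw [← Real.log_exp (-l)]
    refine Real.log_lt_log (by linarith) ?_
    rw [Real.exp_neg, ← one_div, lt_div_iff₀ (Real.exp_pos _), hF]
    rcases max_cases (mgf (σ₁ 0) P θ) (mgf (σ₂ 0) P θ) with hc | hc <;> rw [hc.1] <;> assumption
  obtain ⟨d, hd₁, hd₂⟩ := exists_between hFl
  have hexpF : Real.exp (Real.log F) = F := Real.exp_log (by linarith)
  have hZ := h.LambdaZ_le (Real.log_nonneg hF1) (C := mgf (fun ω => σ₁ 0 ω + σ₂ 0 ω) P θ)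
    (by
      rw [emgf_eq_ofReal_mgf hs₁, hexpF]
      exact ENNReal.ofReal_le_ofReal (le_max_left _ _))
    (by
      rw [emgf_eq_ofReal_mgf hs₂, hexpF]
      exact ENNReal.ofReal_le_ofReal (le_max_right _ _))
    mgf_nonneg (emgf_eq_ofReal_mgf hs).le hd₁
  calc LambdaT P T (-θ) + LambdaZ P σ₁ σ₂ θ ≤ (l : EReal) + d := by
        rw [LambdaT_eq hl]
        gcongr
    _ < 0 := by
        rw [← EReal.coe_add]
        exact_mod_cast (by linarith : l + d < 0)

/-! ### The upper bound for the tail of the stationary maximal dater -/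

lemma tsum_ne_top_of_eventually_le_exp {u : ℕ → ℝ≥0∞} (hu : ∀ n, u n < ∞) {c : ℝ} (hc : c < 0)
    (h : ∀ᶠ n : ℕ in atTop, u n ≤ ENNReal.ofReal (Real.exp (c * n))) : ∑' n, u n ≠ ∞ := by
  have hs : Summable fun n => (u n).toReal := by
    refine .of_norm_bounded_eventually_nat (Real.summable_exp_nat_mul_iff.2 hc) ?_
    filter_upwards [h] with n hn
    rw [Real.norm_of_nonneg ENNReal.toReal_nonneg, mul_comm]
    exact ENNReal.toReal_le_of_le_ofReal (Real.exp_pos _).le hn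
  simpa only [ENNReal.ofReal_toReal (hu _).ne] using hs.tsum_ofReal_ne_top

lemma setOf_lt_stationaryMaximalDater {Ω : Type*} (T σ₁ σ₂ : ℤ → Ω → ℝ) (x : ℝ) :
    {ω | (x : EReal) <
      stationaryMaximalDater (fun k => T k ω) (fun k => σ₁ k ω) (fun k => σ₂ k ω)} =
      ⋃ n : ℕ, {ω | x < randomY T σ₁ σ₂ n ω} := by
  ext ω
  simp only [Set.mem_ofPred_eq, Set.mem_iUnion]
  exact lt_stationaryMaximalDater_iff _ _ _ x

lemma IsInput.limsup_tail_le [IsProbabilityMeasure P] (h : IsInput P T σ₁ σ₂) (hθ : 0 ≤ θ)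
    (hneg : LambdaT P T (-θ) + LambdaZ P σ₁ σ₂ θ < 0) :
    limsup (fun x : ℝ => ((1 / x : ℝ) : EReal) * ENNReal.log (P {ω | (x : EReal) <
      stationaryMaximalDater (fun k => T k ω) (fun k => σ₁ k ω) (fun k => σ₂ k ω)})) atTop
      ≤ (-θ : ℝ) := by
  obtain ⟨c, hc, hc0⟩ := EReal.lt_iff_exists_real_btwn.1 hneg
  have hc0' : c < 0 := by exact_mod_cast hc0
  have hev := h.eventually_emgf_randomY_le hθ hc
  set K := ∑' n, emgf P (randomY T σ₁ σ₂ n) θ with hK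
  have hKfin : K ≠ ∞ := tsum_ne_top_of_eventually_le_exp (h.emgf_randomY_lt_top hθ hev) hc0' hev
  refine EReal.le_of_forall_lt_iff_le.1 fun d hd => ?_
  rw [EReal.coe_lt_coe_iff] at hd
  refine limsup_le_of_le (by isBoundedDefault) ?_
  filter_upwards [eventually_gt_atTop 0, eventually_const_mul_exp_le K.toReal hd] with x hx hx'
  rw [inv_mul_log_le_iff hx, setOf_lt_stationaryMaximalDater]
  calc _ ≤ ∑' n, P {ω | x < randomY T σ₁ σ₂ n ω} := measure_iUnion_le _
    _ ≤ ∑' n, ENNReal.ofReal (Real.exp (-θ * x)) * emgf P (randomY T σ₁ σ₂ n) θ :=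
        ENNReal.tsum_le_tsum fun n => measure_lt_le_emgf (h.aemeasurable_randomY n) hθ x
    _ = ENNReal.ofReal (K.toReal * Real.exp (-θ * x)) := by
        rw [ENNReal.tsum_mul_left, ENNReal.ofReal_mul ENNReal.toReal_nonneg,
          ENNReal.ofReal_toReal hKfin, mul_comm]
    _ ≤ _ := ENNReal.ofReal_le_ofReal hx'

lemma IsInput.limsup_tail_le_neg_thetaStar [IsProbabilityMeasure P] (h : IsInput P T σ₁ σ₂) :
    limsup (fun x : ℝ => ((1 / x : ℝ) : EReal) * ENNReal.log (P {ω | (x : EReal) <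
      stationaryMaximalDater (fun k => T k ω) (fun k => σ₁ k ω) (fun k => σ₂ k ω)})) atTop
      ≤ -thetaStar P T σ₁ σ₂ := by
  rw [EReal.le_neg]
  refine iSup₂_le fun θ hθ => ?_
  rw [EReal.le_neg]
  exact h.limsup_tail_le hθ.1.le hθ.2

/-! ### The lower bound -/

lemma map_randomY_apply (h : IsInput P T σ₁ σ₂) (n : ℕ) {s : Set ℝ} (hs : MeasurableSet s) :
    P.map (fun ω => pathY (fun k => T k ω) (fun k => σ₁ k ω) (fun k => σ₂ k ω) n / (n : ℝ)) s =
      P {ω | randomY T σ₁ σ₂ n ω / n ∈ s} :=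
  Measure.map_apply_of_aemeasurable ((h.aemeasurable_randomY n).div_const _) hs

/-- Reduces the bound by the infimum to one `α` at a time, with `I α` finite. -/
lemma neg_iInf_div_le {I : ℝ → ℝ≥0∞} {L : EReal}
    (h : ∀ α : ℝ, 0 < α → ∀ r : ℝ, 0 ≤ r → I α = ENNReal.ofReal r → ((-(r / α) : ℝ) : EReal) ≤ L) :
    -((⨅ α ∈ Set.Ioi (0 : ℝ), I α / ENNReal.ofReal α : ℝ≥0∞) : EReal) ≤ L := by
  rw [EReal.neg_le]
  by_contra! hcon
  obtain ⟨y, hy, hyL⟩ := EReal.lt_iff_exists_real_btwn.1 hcon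
  have hy0 : 0 ≤ y := EReal.coe_nonneg.1 ((EReal.coe_ennreal_nonneg _).trans hy.le)
  rw [← max_eq_left hy0, ← EReal.coe_ennreal_ofReal, EReal.coe_ennreal_lt_coe_ennreal_iff,
    iInf_lt_iff] at hy
  obtain ⟨α, hα⟩ := hy
  rw [iInf_lt_iff] at hα
  obtain ⟨hα0, hα⟩ := hα
  have hα0' : 0 < α := hα0
  rw [ENNReal.div_lt_iff (.inl (by simpa using hα0')) (.inl ENNReal.ofReal_ne_top),
    ← ENNReal.ofReal_mul hy0] at hα
  have htop : I α ≠ ∞ := (hα.trans ENNReal.ofReal_lt_top).ne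
  have hr := h α hα0' (I α).toReal ENNReal.toReal_nonneg (ENNReal.ofReal_toReal htop).symm
  have hlt : (I α).toReal / α < y := by
    rw [div_lt_iff₀ hα0']
    exact (ENNReal.lt_ofReal_iff_toReal_lt htop).1 hα
  have h₁ : ((-(I α).toReal / α : ℝ) : EReal) ≤ L := by rwa [neg_div]
  have h₂ : -L ≤ ((I α).toReal / α : ℝ) := by
    rw [EReal.neg_le, ← EReal.coe_neg]
    exact hr
  exact absurd (hyL.trans_le h₂) (not_lt.2 (EReal.coe_le_coe_iff.2 hlt.le))

lemma IsInput.neg_iInf_div_le_liminf_tail (h : IsInput P T σ₁ σ₂) {I : ℝ → ℝ≥0∞}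
    (hldp : SatisfiesLDP (fun n : ℕ => P.map (fun ω =>
      pathY (fun k => T k ω) (fun k => σ₁ k ω) (fun k => σ₂ k ω) n / (n : ℝ))) I) :
    -((⨅ α ∈ Set.Ioi (0 : ℝ), I α / ENNReal.ofReal α : ℝ≥0∞) : EReal) ≤
      liminf (fun x : ℝ => ((1 / x : ℝ) : EReal) * ENNReal.log (P {ω | (x : EReal) <
        stationaryMaximalDater (fun k => T k ω) (fun k => σ₁ k ω) (fun k => σ₂ k ω)})) atTop := by
  refine neg_iInf_div_le fun α hα r hr hI => ?_
  refine EReal.ge_of_forall_gt_iff_ge.1 fun d hd => ?_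
  rw [EReal.coe_lt_coe_iff] at hd
  have hd0 : d < 0 := hd.trans_le (neg_nonpos.2 (by positivity))
  have hrd : r / -d < α := by
    rw [div_lt_iff₀ (by linarith)]
    rw [lt_neg, div_lt_iff₀ hα] at hd
    linarith
  -- Taking `β < α` puts `α` in the open set `(β, ∞)`; `β` is close enough to `α` that `d * β < -r`
  -- still holds.
  obtain ⟨β, hβ, hβα⟩ := exists_between hrd
  have hβ0 : 0 < β := lt_of_le_of_lt (div_nonneg hr (by linarith)) hβ
  have hβr : d * β < -r := by
    rw [div_lt_iff₀ (by linarith)] at hβ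
    linarith
  obtain ⟨c, hdc, hcr⟩ := exists_between hβr
  have hlow : (c : EReal) < liminf (fun n : ℕ => ((1 / (n : ℝ) : ℝ) : EReal) *
      ENNReal.log (P.map (fun ω =>
        pathY (fun k => T k ω) (fun k => σ₁ k ω) (fun k => σ₂ k ω) n / (n : ℝ)) (Set.Ioi β)))
      atTop := by
    refine lt_of_lt_of_le ?_ (hldp.lower (Set.Ioi β) isOpen_Ioi)
    rw [EReal.lt_neg_comm]
    refine lt_of_le_of_lt (b := (r : EReal)) ?_ ?_
    · rw [← max_eq_left hr, ← EReal.coe_ennreal_ofReal, EReal.coe_ennreal_le_coe_ennreal_iff, ← hI]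
      exact iInf₂_le α hβα
    · rw [← EReal.coe_neg, EReal.coe_lt_coe_iff]
      linarith
  have hlow' := eventually_exp_le_of_lt_liminf hlow
  have hceil : Tendsto (fun x : ℝ => ⌈x / β⌉₊) atTop atTop :=
    tendsto_nat_ceil_atTop.comp (tendsto_id.atTop_div_const hβ0)
  have hc0 : c < 0 := by linarith
  have hdcβ : d < c / β := by rwa [lt_div_iff₀ hβ0]
  refine le_liminf_of_le (by isBoundedDefault) ?_
  filter_upwards [hceil.eventually hlow', eventually_gt_atTop 0,
    eventually_const_mul_exp_le (Real.exp (-c)) hdcβ] with x hx hx0 hxd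
  rw [le_inv_mul_log_iff hx0, setOf_lt_stationaryMaximalDater]
  set n := ⌈x / β⌉₊ with hn
  have hn0 : (0 : ℝ) < n := Nat.cast_pos.2 (Nat.ceil_pos.2 (by positivity))
  have hxn : x ≤ n * β := (div_le_iff₀ hβ0).1 (Nat.le_ceil _)
  -- Rounding up costs at most the factor `exp c`, which the gap `d < c / β` absorbs.
  have hnx : (n : ℝ) < x / β + 1 := Nat.ceil_lt_add_one (by positivity)
  calc ENNReal.ofReal (Real.exp (d * x)) ≤ ENNReal.ofReal (Real.exp (c * n)) := by
        refine ENNReal.ofReal_le_ofReal ?_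
        calc Real.exp (d * x) = Real.exp c * (Real.exp (-c) * Real.exp (d * x)) := by
              rw [← mul_assoc, ← Real.exp_add]
              simp
          _ ≤ Real.exp c * Real.exp (c / β * x) := by gcongr
          _ ≤ Real.exp (c * n) := by
              rw [← Real.exp_add, Real.exp_le_exp]
              have : c * (x / β + 1) ≤ c * n := mul_le_mul_of_nonpos_left hnx.le hc0.le
              calc c + c / β * x = c * (x / β + 1) := by ring
                _ ≤ _ := this
    _ ≤ P {ω | randomY T σ₁ σ₂ n ω / n ∈ Set.Ioi β} := by
        rw [← map_randomY_apply h n measurableSet_Ioi]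
        exact hx
    _ ≤ P (⋃ n : ℕ, {ω | x < randomY T σ₁ σ₂ n ω}) := by
        refine measure_mono fun ω hω => Set.mem_iUnion.2 ⟨n, ?_⟩
        rw [Set.mem_ofPred_eq, Set.mem_Ioi, lt_div_iff₀ hn0] at hω
        exact hxn.trans_lt (by linarith)

/-! ### Comparison of the two exponents -/

/-- A pointwise bound that localizes `exp (θ y)` on a grid. -/
lemma exp_le_of_grid {θ₀ θ₂ a δ n : ℝ} (hθ : 0 ≤ θ) (h₀ : θ₀ ≤ θ) (h₂ : θ ≤ θ₂) (hδ : 0 < δ)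
    (hn : 0 < n) (N : ℕ) (y : ℝ) :
    ENNReal.ofReal (Real.exp (θ * y)) ≤
      ENNReal.ofReal (Real.exp ((θ - θ₀) * (a * n))) * ENNReal.ofReal (Real.exp (θ₀ * y)) +
      ∑ i ∈ Finset.range N, ENNReal.ofReal (Real.exp (θ * ((a + i * δ + δ) * n))) *
        (Set.Ici ((a + i * δ) * n)).indicator 1 y +
      ENNReal.ofReal (Real.exp (-((θ₂ - θ) * ((a + N * δ) * n)))) *
        ENNReal.ofReal (Real.exp (θ₂ * y)) := by
  rcases le_total y (a * n) with hy | hy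
  · rw [add_assoc]
    refine le_trans ?_ (le_add_of_nonneg_right zero_le)
    rw [← ENNReal.ofReal_mul (Real.exp_pos _).le, ← Real.exp_add]
    refine ENNReal.ofReal_le_ofReal (Real.exp_le_exp.2 ?_)
    have := mul_le_mul_of_nonneg_left hy (sub_nonneg.2 h₀)
    linarith
  rcases le_total ((a + N * δ) * n) y with hy' | hy'
  · refine le_trans ?_ (le_add_of_nonneg_left zero_le)
    rw [← ENNReal.ofReal_mul (Real.exp_pos _).le, ← Real.exp_add]
    refine ENNReal.ofReal_le_ofReal (Real.exp_le_exp.2 ?_)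
    have := mul_le_mul_of_nonneg_left hy' (sub_nonneg.2 h₂)
    linarith
  -- The floor below would equal `N` at the right end of the grid, so this edge is assigned to the
  -- last term.
  rcases eq_or_lt_of_le hy' with hy' | hy'
  · refine le_trans ?_ (le_add_of_nonneg_left zero_le)
    rw [← ENNReal.ofReal_mul (Real.exp_pos _).le, ← Real.exp_add, hy']
    refine ENNReal.ofReal_le_ofReal (Real.exp_le_exp.2 ?_)
    linarith
  refine le_trans ?_ (le_add_of_nonneg_right zero_le)
  refine le_trans ?_ (le_add_of_nonneg_left zero_le)
  have hz : 0 ≤ (y / n - a) / δ := div_nonneg (sub_nonneg.2 ((le_div_iff₀ hn).2 hy)) hδ.le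
  set i := ⌊(y / n - a) / δ⌋₊ with hi
  have hi₁ : (a + i * δ) * n ≤ y := by
    have := Nat.floor_le hz
    rw [← hi, le_div_iff₀ hδ, le_sub_iff_add_le, le_div_iff₀ hn] at this
    linarith
  have hi₂ : y ≤ (a + i * δ + δ) * n := by
    have := (Nat.lt_floor_add_one ((y / n - a) / δ)).le
    rw [← hi, div_le_iff₀ hδ, sub_le_iff_le_add, div_le_iff₀ hn] at this
    linarith
  have hiN : i < N := by
    rw [hi, Nat.floor_lt hz, div_lt_iff₀ hδ, sub_lt_iff_lt_add, div_lt_iff₀ hn]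
    linarith
  refine le_trans ?_ (Finset.single_le_sum (f := fun i : ℕ =>
    ENNReal.ofReal (Real.exp (θ * ((a + i * δ + δ) * n))) *
      (Set.Ici ((a + i * δ) * n)).indicator (1 : ℝ → ℝ≥0∞) y)
    (fun _ _ => zero_le) (Finset.mem_range.2 hiN))
  rw [Set.indicator_of_mem (Set.mem_Ici.2 hi₁), Pi.one_apply, mul_one]
  gcongr

lemma emgf_le_of_grid {Y : Ω → ℝ} (hY : AEMeasurable Y P) {θ₀ θ₂ a δ n : ℝ} (hθ : 0 ≤ θ)
    (h₀ : θ₀ ≤ θ) (h₂ : θ ≤ θ₂) (hδ : 0 < δ) (hn : 0 < n) (N : ℕ) :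
    emgf P Y θ ≤
      ENNReal.ofReal (Real.exp ((θ - θ₀) * (a * n))) * emgf P Y θ₀ +
      ∑ i ∈ Finset.range N, ENNReal.ofReal (Real.exp (θ * ((a + i * δ + δ) * n))) *
        P {ω | (a + i * δ) * n ≤ Y ω} +
      ENNReal.ofReal (Real.exp (-((θ₂ - θ) * ((a + N * δ) * n)))) * emgf P Y θ₂ := by
  have hind : ∀ i : ℕ, AEMeasurable (fun ω =>
      (Set.Ici ((a + i * δ) * n)).indicator (1 : ℝ → ℝ≥0∞) (Y ω)) P := fun i =>
    (measurable_one.indicator measurableSet_Ici).comp_aemeasurable hY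
  refine (lintegral_mono fun ω => exp_le_of_grid (a := a) hθ h₀ h₂ hδ hn N (Y ω)).trans_eq ?_
  rw [lintegral_add_left' (by fun_prop), lintegral_add_left' (by fun_prop),
    lintegral_finsetSum' _ (fun i _ => by have := hind i; fun_prop),
    lintegral_const_mul' _ _ ENNReal.ofReal_ne_top, lintegral_const_mul' _ _ ENNReal.ofReal_ne_top]
  congr 2
  refine Finset.sum_congr rfl fun i _ => ?_
  rw [lintegral_const_mul' _ _ ENNReal.ofReal_ne_top]
  congr 1
  have hset : NullMeasurableSet {ω | (a + i * δ) * n ≤ Y ω} P :=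
    hY.nullMeasurableSet_preimage measurableSet_Ici
  rw [← lintegral_indicator_one₀ hset]
  rfl

/-- If the upper tails of `Y n / n` decay at rates exceeding `θ' a`, then the exponential moments
of order `θ < θ'` decay, provided that a lower order moment decays and a higher order one grows at
most exponentially. -/
lemma exists_eventually_emgf_le_exp {Y : ℕ → Ω → ℝ} (hY : ∀ n, AEMeasurable (Y n) P)
    {θ₀ θ' θ₂ c K : ℝ} (hθ : 0 < θ) (h₀ : θ₀ < θ) (h' : θ < θ') (h₂ : θ < θ₂) (hc : c < 0)
    (hm₀ : ∀ᶠ n : ℕ in atTop, emgf P (Y n) θ₀ ≤ ENNReal.ofReal (Real.exp (c * n)))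
    (hm₂ : ∀ᶠ n : ℕ in atTop, emgf P (Y n) θ₂ ≤ ENNReal.ofReal (Real.exp (K * n)))
    (htail : ∀ a : ℝ, 0 < a → ∀ d : ℝ, -(θ' * a) < d →
      ∀ᶠ n : ℕ in atTop, P {ω | a * n ≤ Y n ω} ≤ ENNReal.ofReal (Real.exp (d * n))) :
    ∃ e < 0, ∀ᶠ n : ℕ in atTop, emgf P (Y n) θ ≤ ENNReal.ofReal (Real.exp (e * n)) := by
  have hθ₀ : 0 < θ - θ₀ := sub_pos.2 h₀
  -- With this `a` the region `Y n ≤ a * n` contributes at most `exp (c * n / 2)`.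
  obtain ⟨a, ha, hac⟩ : ∃ a : ℝ, 0 < a ∧ (θ - θ₀) * a = -c / 2 :=
    ⟨-c / 2 / (θ - θ₀), div_pos (by linarith) hθ₀, by field_simp⟩
  obtain ⟨γ, hγ⟩ : ∃ γ, γ = (θ' - θ) * a := ⟨_, rfl⟩
  have hγ0 : 0 < γ := hγ ▸ mul_pos (sub_pos.2 h') ha
  -- The width of a cell costs `γ / 4` in the exponent and the slack in the tail bound another `γ /
  -- 4`, out of a gain of at least `γ`; each cell keeps the rate `-γ / 2`.
  obtain ⟨δ, hδ, hδγ⟩ : ∃ δ : ℝ, 0 < δ ∧ θ * δ = γ / 4 :=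
    ⟨γ / 4 / θ, by positivity, by field_simp⟩
  -- The grid reaches far enough for the last term to have rate at most `-1` despite the growth rate
  -- `K`.
  obtain ⟨N, hN⟩ : ∃ N : ℕ, (K + 1) / ((θ₂ - θ) * δ) ≤ N := exists_nat_ge _
  rw [div_le_iff₀ (mul_pos (sub_pos.2 h₂) hδ)] at hN
  have hcells : ∀ᶠ n : ℕ in atTop, ∀ i ∈ Finset.range N, P {ω | (a + i * δ) * n ≤ Y n ω} ≤
      ENNReal.ofReal (Real.exp ((-(θ' * (a + i * δ)) + γ / 4) * n)) :=
    (Filter.eventually_all_finset _).2 fun i _ =>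
      htail (a + i * δ) (by positivity) _ (by linarith)
  obtain ⟨e, he⟩ : ∃ e, e = max (c / 2) (max (-γ / 2) (-1)) := ⟨_, rfl⟩
  have he₁ : c / 2 ≤ e := he ▸ le_max_left _ _
  have he₂ : -γ / 2 ≤ e := he ▸ (le_max_left _ _).trans (le_max_right _ _)
  have he₃ : -1 ≤ e := he ▸ (le_max_right _ _).trans (le_max_right _ _)
  have he0 : e < 0 := by
    rw [he]
    exact max_lt (by linarith) (max_lt (by linarith) (by norm_num))
  refine ⟨e / 2, by linarith, ?_⟩
  filter_upwards [hm₀, hm₂, hcells, eventually_gt_atTop 0,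
    tendsto_natCast_atTop_atTop.eventually
      (eventually_const_mul_exp_le (N + 2 : ℝ) (by linarith : e < e / 2))]
    with n hn₀ hn₂ hcell hn hfinal
  have hn' : (0 : ℝ) < n := Nat.cast_pos.2 hn
  have hcombine : ∀ {s t : ℝ} {u : ℝ≥0∞}, u ≤ ENNReal.ofReal (Real.exp (t * n)) → s + t ≤ e →
      ENNReal.ofReal (Real.exp (s * n)) * u ≤ ENNReal.ofReal (Real.exp (e * n)) := by
    intro s t u hu hst
    calc _ ≤ ENNReal.ofReal (Real.exp (s * n)) * ENNReal.ofReal (Real.exp (t * n)) := by gcongr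
      _ = ENNReal.ofReal (Real.exp ((s + t) * n)) := by
          rw [← ENNReal.ofReal_mul (Real.exp_pos _).le, ← Real.exp_add, add_mul]
      _ ≤ _ := by gcongr
  refine (emgf_le_of_grid (a := a) (hY n) hθ.le h₀.le h₂.le hδ hn' N).trans ?_
  calc _ ≤ ENNReal.ofReal (Real.exp (e * n)) +
        ∑ i ∈ Finset.range N, ENNReal.ofReal (Real.exp (e * n)) +
        ENNReal.ofReal (Real.exp (e * n)) := by
        refine add_le_add (add_le_add ?_ (Finset.sum_le_sum fun i hi => ?_)) ?_
        · rw [← mul_assoc]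
          exact hcombine hn₀ (by linarith)
        · rw [← mul_assoc]
          refine hcombine (hcell i hi) ?_
          have : 0 ≤ (θ' - θ) * (i * δ) := mul_nonneg (sub_pos.2 h').le (by positivity)
          linarith
        · rw [← mul_assoc, ← neg_mul]
          refine hcombine hn₂ ?_
          have : 0 ≤ (θ₂ - θ) * a := mul_nonneg (sub_pos.2 h₂).le ha.le
          linarith
    _ = ENNReal.ofReal ((N + 2 : ℝ) * Real.exp (e * n)) := by
        rw [Finset.sum_const, Finset.card_range, nsmul_eq_mul, ENNReal.ofReal_mul (by positivity),
          ENNReal.ofReal_add (by positivity) (by positivity), ENNReal.ofReal_natCast,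
          ENNReal.ofReal_ofNat]
        ring
    _ ≤ _ := ENNReal.ofReal_le_ofReal hfinal

/-- On `[a, ∞)` the rate function satisfies `I x ≥ θ' * x ≥ θ' * a`, and the LDP upper bound applies
to this closed set. -/
lemma IsInput.eventually_measure_le_exp (h : IsInput P T σ₁ σ₂) {I : ℝ → ℝ≥0∞}
    (hldp : SatisfiesLDP (fun n : ℕ => P.map (fun ω =>
      pathY (fun k => T k ω) (fun k => σ₁ k ω) (fun k => σ₂ k ω) n / (n : ℝ))) I)
    {θ' : ℝ} (hθ' : 0 ≤ θ')
    (hI : ENNReal.ofReal θ' ≤ ⨅ α ∈ Set.Ioi (0 : ℝ), I α / ENNReal.ofReal α)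
    {a d : ℝ} (ha : 0 < a) (hd : -(θ' * a) < d) :
    ∀ᶠ n : ℕ in atTop, P {ω | a * n ≤ randomY T σ₁ σ₂ n ω} ≤
      ENNReal.ofReal (Real.exp (d * n)) := by
  have hinf : ENNReal.ofReal (θ' * a) ≤ ⨅ x ∈ Set.Ici a, I x := by
    refine le_iInf₂ fun x (hx : a ≤ x) => ?_
    have hx0 : 0 < x := ha.trans_le hx
    have := hI.trans (iInf₂_le x hx0)
    rw [ENNReal.le_div_iff_mul_le (.inl (by simpa using hx0)) (.inl ENNReal.ofReal_ne_top),
      ← ENNReal.ofReal_mul hθ'] at this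
    exact (ENNReal.ofReal_le_ofReal (by gcongr)).trans this
  have hup := hldp.upper (Set.Ici a) isClosed_Ici
  have hlt := hup.trans_lt (b := -((⨅ x ∈ Set.Ici a, I x : ℝ≥0∞) : EReal)) (c := (d : EReal)) (by
    rw [EReal.neg_lt_comm, ← EReal.coe_neg]
    refine lt_of_lt_of_le ?_ (EReal.coe_ennreal_le_coe_ennreal_iff.2 hinf)
    rw [EReal.coe_ennreal_ofReal, max_eq_left (by positivity), EReal.coe_lt_coe_iff]
    linarith)
  filter_upwards [eventually_le_exp_of_limsup_lt hlt, eventually_gt_atTop 0] with n hn hn0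
  rw [map_randomY_apply h n measurableSet_Ici] at hn
  have hn0' : (0 : ℝ) < n := Nat.cast_pos.2 hn0
  simpa only [Set.mem_Ici, le_div_iff₀ hn0'] using hn

lemma IsInput.iInf_div_le_thetaStar [IsProbabilityMeasure P] (h : IsInput P T σ₁ σ₂)
    {I : ℝ → ℝ≥0∞}
    (hldp : SatisfiesLDP (fun n : ℕ => P.map (fun ω =>
      pathY (fun k => T k ω) (fun k => σ₁ k ω) (fun k => σ₂ k ω) n / (n : ℝ))) I)
    (hpos : ∃ θ : ℝ, 0 < θ ∧ LambdaT P T (-θ) + LambdaZ P σ₁ σ₂ θ < 0)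
    (hfin : ∃ ε : ℝ, 0 < ε ∧ ∀ θ : ℝ, (θ : EReal) = thetaStar P T σ₁ σ₂ + (ε : EReal) →
      LambdaZ P σ₁ σ₂ θ < ⊤) :
    ((⨅ α ∈ Set.Ioi (0 : ℝ), I α / ENNReal.ofReal α : ℝ≥0∞) : EReal) ≤ thetaStar P T σ₁ σ₂ := by
  by_contra! hcon
  obtain ⟨θ₀, hθ₀, hneg⟩ := hpos
  have hmem : ∀ {θ : ℝ}, 0 < θ → LambdaT P T (-θ) + LambdaZ P σ₁ σ₂ θ < 0 →
      (θ : EReal) ≤ thetaStar P T σ₁ σ₂ := fun {θ} h₁ h₂ =>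
    le_iSup₂ (f := fun (θ : ℝ) (_ : θ ∈ {θ : ℝ | 0 < θ ∧
      LambdaT P T (-θ) + LambdaZ P σ₁ σ₂ θ < 0}) => (θ : EReal)) θ ⟨h₁, h₂⟩
  have hθ₀t := hmem hθ₀ hneg
  obtain ⟨θ', htθ', hθ'I⟩ := EReal.lt_iff_exists_real_btwn.1 hcon
  -- Being below the infimum and at least `θ₀`, `θ*` is real, so the finiteness condition has
  -- content.
  obtain ⟨t, ht⟩ : ∃ t : ℝ, (t : EReal) = thetaStar P T σ₁ σ₂ :=
    ⟨_, EReal.coe_toReal (hcon.trans_le le_top).ne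
      ((EReal.bot_lt_coe θ₀).trans_le hθ₀t).ne'⟩
  rw [← ht, EReal.coe_le_coe_iff] at hθ₀t
  rw [← ht, EReal.coe_lt_coe_iff] at htθ'
  obtain ⟨ε, hε, hfin⟩ := hfin
  have hZ : LambdaZ P σ₁ σ₂ (t + ε) < ⊤ := hfin _ (by rw [← ht, EReal.coe_add])
  -- Below `θ'` the tails win over `exp (θ y)`; below `t + ε` a higher moment controls the far
  -- region.
  obtain ⟨θ, htθ, hθlt⟩ := exists_between (lt_min htθ' (by linarith : t < t + ε))
  rw [lt_min_iff] at hθlt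
  have hθ : 0 < θ := by linarith
  obtain ⟨c, hc, hc0⟩ := EReal.lt_iff_exists_real_btwn.1 hneg
  obtain ⟨l, -, hl⟩ := h.exists_emgf_interarrival_eq (θ := t + ε) (by linarith)
  have hsum : LambdaT P T (-(t + ε)) + LambdaZ P σ₁ σ₂ (t + ε) < ⊤ := by
    rw [LambdaT_eq hl]
    exact EReal.add_lt_top (EReal.coe_ne_top _) hZ.ne
  obtain ⟨K, hK, -⟩ := EReal.lt_iff_exists_real_btwn.1 hsum
  have hI : ENNReal.ofReal θ' ≤ ⨅ α ∈ Set.Ioi (0 : ℝ), I α / ENNReal.ofReal α := by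
    rw [← EReal.coe_ennreal_le_coe_ennreal_iff, EReal.coe_ennreal_ofReal,
      max_eq_left (by linarith)]
    exact hθ'I.le
  obtain ⟨e, he, hev⟩ := exists_eventually_emgf_le_exp h.aemeasurable_randomY hθ (hθ₀t.trans_lt htθ)
    hθlt.1 hθlt.2 (by exact_mod_cast hc0 : c < 0) (h.eventually_emgf_randomY_le hθ₀.le hc)
    (h.eventually_emgf_randomY_le (by linarith) hK)
    fun a ha d hd => h.eventually_measure_le_exp hldp (by linarith) hI ha hd
  have hlt := (h.LambdaT_add_LambdaZ_le hθ.le hev).trans_lt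
    (by exact_mod_cast he : (e : EReal) < 0)
  have := hmem hθ hlt
  rw [← ht, EReal.coe_le_coe_iff] at this
  linarith

end Tandem

theorem corollary2 {Ω : Type*} [MeasurableSpace Ω] (P : Measure Ω) [IsProbabilityMeasure P]
    -- arrival epochs at the first station, service times at the two stations
    (T σ₁ σ₂ : ℤ → Ω → ℝ)
    -- the inter-arrival times are nonnegative i.i.d. random variables with a finite mean
    (hτ_meas : ∀ n, Measurable fun ω => T (n + 1) ω - T n ω)
    (hτ_nonneg : ∀ n, ∀ᵐ ω ∂P, 0 ≤ T (n + 1) ω - T n ω)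
    (hτ_indep : iIndepFun (fun (n : ℤ) ω => T (n + 1) ω - T n ω) P)
    (hτ_ident : ∀ n : ℤ,
      IdentDistrib (fun ω => T (n + 1) ω - T n ω) (fun ω => T 1 ω - T 0 ω) P P)
    (hτ_int : Integrable (fun ω => T 1 ω - T 0 ω) P)
    -- the pairs of service times are i.i.d. with nonnegative components
    (hσ₁_meas : ∀ n, Measurable (σ₁ n)) (hσ₂_meas : ∀ n, Measurable (σ₂ n))
    (hσ₁_nonneg : ∀ n, ∀ᵐ ω ∂P, 0 ≤ σ₁ n ω) (hσ₂_nonneg : ∀ n, ∀ᵐ ω ∂P, 0 ≤ σ₂ n ω)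
    (hσ_indep : iIndepFun (fun (n : ℤ) ω => (σ₁ n ω, σ₂ n ω)) P)
    (hσ_ident : ∀ n : ℤ,
      IdentDistrib (fun ω => (σ₁ n ω, σ₂ n ω)) (fun ω => (σ₁ 0 ω, σ₂ 0 ω)) P P)
    -- the sequence of inter-arrival times is independent of the sequence of service times
    (h_indep : IndepFun (fun ω (n : ℤ) => T (n + 1) ω - T n ω)
      (fun ω (n : ℤ) => (σ₁ n ω, σ₂ n ω)) P)
    -- `Z_0 = Z_{[0,0]}` is light-tailed
    (h_light : ∀ᶠ θ in 𝓝 (0 : ℝ), Integrable (fun ω => Real.exp (θ *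
      Tandem.maximalDater (fun k => T k ω) (fun k => σ₁ k ω) (fun k => σ₂ k ω) 0 0)) P)
    -- stability
    (h_stable : max (∫ ω, σ₁ 0 ω ∂P) (∫ ω, σ₂ 0 ω ∂P) < ∫ ω, (T 1 ω - T 0 ω) ∂P)
    -- `Y_n / n` satisfies a large deviation principle with a good rate function
    (I : ℝ → ℝ≥0∞) (hI : Tandem.IsGoodRateFunction I)
    (h_ldp : Tandem.SatisfiesLDP (fun n : ℕ => P.map (fun ω =>
      Tandem.pathY (fun k => T k ω) (fun k => σ₁ k ω) (fun k => σ₂ k ω) n / (n : ℝ))) I)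
    -- `Λ_Z(θ* + ε) < ∞` for some `ε > 0`; nothing is required if `θ* = ∞`
    (h_fin : ∃ ε : ℝ, 0 < ε ∧ ∀ θ : ℝ, (θ : EReal) = Tandem.thetaStar P T σ₁ σ₂ + (ε : EReal) →
      Tandem.LambdaZ P σ₁ σ₂ θ < ⊤) :
    Tendsto (fun x : ℝ => ((1 / x : ℝ) : EReal) * ENNReal.log (P {ω | (x : EReal) <
        Tandem.stationaryMaximalDater (fun k => T k ω) (fun k => σ₁ k ω) (fun k => σ₂ k ω)}))
      atTop (𝓝 (-Tandem.thetaStar P T σ₁ σ₂)) ∧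
    -Tandem.thetaStar P T σ₁ σ₂ =
      -((⨅ α ∈ Set.Ioi (0 : ℝ), I α / ENNReal.ofReal α : ℝ≥0∞) : EReal) := by
  have h : Tandem.IsInput P T σ₁ σ₂ :=
    ⟨hτ_meas, hτ_nonneg, hτ_indep, hτ_ident, hσ₁_meas, hσ₂_meas, hσ₁_nonneg, hσ₂_nonneg,
      hσ_indep, hσ_ident, h_indep⟩
  have hlight : ∀ᶠ θ in 𝓝 (0 : ℝ),
      Integrable (fun ω => Real.exp (θ * (σ₁ 0 ω + σ₂ 0 ω))) P := by
    filter_upwards [h_light] with θ hθ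
    -- A lone customer leaves at `T 0 + σ₁ 0 + σ₂ 0`, so the arrival epoch cancels.
    convert hθ using 4 with ω
    simp only [Tandem.maximalDater, Tandem.lastActivity, sub_self, Int.toNat_zero,
      Tandem.departure₂, Tandem.departure₁]
    ring
  have hcomp := h.iInf_div_le_thetaStar h_ldp
    (h.exists_LambdaT_add_LambdaZ_lt_zero hτ_int hlight h_stable) h_fin
  have hlow := h.neg_iInf_div_le_liminf_tail h_ldp
  have hup := h.limsup_tail_le_neg_thetaStar
  have hneg := EReal.neg_le_neg_iff.2 hcomp
  have hle : liminf (fun x : ℝ => ((1 / x : ℝ) : EReal) * ENNReal.log (P {ω | (x : EReal) <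
      Tandem.stationaryMaximalDater (fun k => T k ω) (fun k => σ₁ k ω) (fun k => σ₂ k ω)}))
      atTop ≤ limsup (fun x : ℝ => ((1 / x : ℝ) : EReal) * ENNReal.log (P {ω | (x : EReal) <
      Tandem.stationaryMaximalDater (fun k => T k ω) (fun k => σ₁ k ω) (fun k => σ₂ k ω)}))
      atTop := liminf_le_limsup
  exact ⟨tendsto_of_le_liminf_of_limsup_le (hneg.trans hlow) hup,
    le_antisymm hneg (hlow.trans (hle.trans hup))⟩
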